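/- A \emph{graphing} is a quadruple $\mathbf G=(J,\mathcal B,E,\lambda)$, where $(J,\mathcal B)$ is a standard Borel space, $E\subseteq J\times J$ is a symmetric Borel set disjoint from the diagonal (the edge set; each edge is represented by both of its ordered pairs), all degrees of the graph $(J,E)$ are bounded by some integer $D\ge 0$, and $\lambda$ is a probability measure on $\mathcal B$ such that $\int_A \deg_B\,d\lambda=\int_B\deg_A\,d\lambda$ for all $A,B\in\mathcal B$, where $\deg_B(x)$ is the number of edges from $x$ to $B$. Let $\overline d=\int_J\deg_J\,d\lambda$ be the average degree. The edge measure of $\mathbf G$ is the measure on $J\times J$ given by $\eta(S)=\frac1{\overline d}\int_J|\{y:(x,y)\in S\cap E\}|\,d\lambda(x)$ (with $\eta=0$ if $\overline d=0$). For a Borel set $X\subseteq E$, let $(J,X)$ be the graph in which two distinct nodes $x,y$ are adjacent if $(x,y)\in X$ or $(y,x)\in X$ (for symmetric $X$ these conditions are the same), let $X_u$ be the node set of the connected component of $(J,X)$ containing $u$, and define $$\rho(X)=1-\int_J\frac1{|X_u|}\,d\lambda(u),$$ where $1/|X_u|=0$ if $X_u$ is infinite. \textbf{Theorem.} Let $\mathbf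 G$ be a graphing. For every Borel set $X\subseteq E$ the function $u\mapsto 1/|X_u|$ is Borel, so that $\rho(X)$ is well defined; and $\eta(A\times B)=\frac1{\overline d}\int_A\deg_B\,d\lambda$ for all $A,B\in\mathcal B$ (both sides being read as $0$ if $\overline d=0$). The setfunction $\rho$ on the Borel subsets of $E$ is nonnegative and (1) increasing: $\rho(X)\le\rho(Y)$ if $X\subseteq Y$; (2) submodular: $\rho(X\cup Y)+\rho(X\cap Y)\le\rho(X)+\rho(Y)$; (3) strongly bounded: there is a finite measure $\alpha$ on $J\times J$ such that $\rho(X)\le\alpha(X)$ for all Borel sets $X\subseteq E$; (4) continuous from above: if $A_1\supseteq A_2\supseteq\cdots$ are Borel subsets of $E$, then $\rho(A_n)\to\rho\big(\bigcap_i A_i\big)$; (5) absolutely continuous with respect to $\eta$: for every $\varepsilon>0$ there is a $\delta>0$ such that $|\rho(S)|<\varepsilon$ for every Borel set $S\subseteq E$ with $\eta(S)<\delta$. Moreover, $\rho$ generalizes the normalized rank function of the cycle matroid: if $\mathbf G$ is a nonempty finite graph on node set $V$ with the uniform distribution $\lambda$ on $V$, then $\rho(X)=r(X)/|V|$ for every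 set $X$ of edges, where $r(X)$, the rank of $X$ in the cycle matroid, is the maximum number of edges of a forest contained in $(V,X)$. -/

import Mathlib

open MeasureTheory Filter Topology
open scoped ENNReal

universe u v

/-- The number of elements of a set, as an extended nonnegative real (`∞` for infinite sets). -/
noncomputable def setSize {α : Type*} (s : Set α) : ℝ≥0∞ := (s.encard : ℝ≥0∞)

/-- The simple graph on `J` whose edges are the pairs in `X`: `x` and `y` are adjacent if they are
distinct and at least one of `(x, y)`, `(y, x)` is in `X` (for symmetric `X`, both are). -/
def edgeGraph {J : Type*} (X : Set (J × J)) : SimpleGraph J :=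
  SimpleGraph.fromRel fun x y => (x, y) ∈ X

/-- The node set of the connected component of the graph `(J, X)` that contains `x`. -/
def componentOf {J : Type*} (X : Set (J × J)) (x : J) : Set J :=
  {y | (edgeGraph X).Reachable x y}

/-- A graphing: a symmetric, loopless Borel graph `E` of bounded degree on a standard Borel space
`J`, with a probability measure `lam` such that `∫_A deg_B = ∫_B deg_A` for all Borel `A`, `B`,
where `deg_B x` is the number of edges from `x` to `B`. -/
structure Graphing (J : Type*) [MeasurableSpace J] [StandardBorelSpace J] where
  /-- The edge set; an edge `xy` is represented by both `(x, y)` and `(y, x)`. -/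
  E : Set (J × J)
  /-- The probability measure on the node set. -/
  lam : Measure J
  measurableSet_E : MeasurableSet E
  symm_E : ∀ x y, (x, y) ∈ E → (y, x) ∈ E
  irrefl_E : ∀ x, (x, x) ∉ E
  exists_degree_le : ∃ D : ℕ, ∀ x, setSize {y | (x, y) ∈ E} ≤ D
  isProbabilityMeasure_lam : IsProbabilityMeasure lam
  measure_preserving : ∀ A B : Set J, MeasurableSet A → MeasurableSet B →
    ∫⁻ x in A, setSize {y | y ∈ B ∧ (x, y) ∈ E} ∂lam =
      ∫⁻ x in B, setSize {y | y ∈ A ∧ (x, y) ∈ E} ∂lam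

namespace Graphing

variable {J : Type*} [MeasurableSpace J] [StandardBorelSpace J] (G : Graphing J)

/-- The number `deg_B x` of edges from `x` to `B`. -/
noncomputable def degTo (B : Set J) (x : J) : ℝ≥0∞ := setSize {y | y ∈ B ∧ (x, y) ∈ G.E}

/-- The average degree of the graphing. -/
noncomputable def avgDegree : ℝ≥0∞ := ∫⁻ x, G.degTo Set.univ x ∂G.lam

/-- The edge measure `η`: the measure `S ↦ d⁻¹ ∫ #{y | (x, y) ∈ S ∩ E} dlam(x)` on `J × J`, where
`d` is the average degree (it is the zero measure if `d = 0`). -/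
noncomputable def edgeMeasure : Measure (J × J) :=
  G.avgDegree⁻¹ • G.lam.bind fun x =>
    Measure.sum fun y : {y : J // (x, y) ∈ G.E} => Measure.dirac (x, y.1)

/-- The Borel subsets of the edge set. -/
def borelEdgeSets : Set (Set (J × J)) := {X | MeasurableSet X ∧ X ⊆ G.E}

/-- `1 / |component of (J, X) containing x|`, which is `0` for infinite components. -/
noncomputable def invComponentSize (X : Set (J × J)) (x : J) : ℝ≥0∞ :=
  (setSize (componentOf X x))⁻¹

/-- The rank function `ρ(X) = 1 - E(1 / |component of (J, X) containing x|)`, `x` random from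
`lam`. -/
noncomputable def rho (X : Set (J × J)) : ℝ :=
  1 - (∫⁻ x, invComponentSize X x ∂G.lam).toReal

end Graphing

/-- The set of ordered pairs of adjacent nodes of a graph. -/
def adjPairs {V : Type*} (H : SimpleGraph V) : Set (V × V) := {p | H.Adj p.1 p.2}

/-- A finite graph, with the uniform distribution on its nodes, as a graphing. -/
noncomputable def Graphing.ofFinite {V : Type*} [Finite V] [Nonempty V] [MeasurableSpace V]
    [DiscreteMeasurableSpace V] (H : SimpleGraph V) : Graphing V where
  E := adjPairs H
  lam := ProbabilityTheory.uniformOn Set.univ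
  measurableSet_E := .of_discrete
  symm_E _ _ h := SimpleGraph.Adj.symm h
  irrefl_E x h := H.irrefl h
  exists_degree_le := by
    refine ⟨Nat.card V, fun x => ?_⟩
    have h : {y | (x, y) ∈ adjPairs H}.encard ≤ (Nat.card V : ℕ∞) := by
      refine (Set.encard_le_encard (Set.subset_univ _)).trans ?_
      rw [Set.encard_univ, ENat.card_eq_coe_natCard]
    unfold setSize
    exact_mod_cast ENat.toENNReal_le.mpr h
  isProbabilityMeasure_lam :=
    ProbabilityTheory.isProbabilityMeasure_uniformOn Set.finite_univ Set.univ_nonempty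
  measure_preserving A B _ _ := by
    have := Fintype.ofFinite V
    have hs : ∀ s : Set V, setSize s = ∑ y, s.indicator (fun _ => (1 : ℝ≥0∞)) y := by
      intro s
      rw [setSize, ← Measure.count_apply (.of_discrete), ← lintegral_indicator_one (.of_discrete),
        lintegral_count, tsum_fintype]
      rfl
    have hc : ∀ x : V, (ProbabilityTheory.uniformOn (Set.univ : Set V)) {x}
        = (Fintype.card V : ℝ≥0∞)⁻¹ := by
      intro x
      simp [ProbabilityTheory.uniformOn_univ]
    have e : ∀ (A B : Set V) (x : V),
        A.indicator (fun x => setSize {y | y ∈ B ∧ (x, y) ∈ adjPairs H}) x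
        = ∑ y, {p : V × V | p.1 ∈ A ∧ p.2 ∈ B ∧ H.Adj p.1 p.2}.indicator
          (fun _ => (1 : ℝ≥0∞)) (x, y) := by
      intro A B x
      by_cases hx : x ∈ A
      · rw [Set.indicator_of_mem hx, hs]
        refine Finset.sum_congr rfl fun y _ => ?_
        by_cases hy : y ∈ B ∧ H.Adj x y <;> simp [Set.indicator, hx, hy, adjPairs]
      · simp [Set.indicator, hx]
    rw [← lintegral_indicator (.of_discrete), ← lintegral_indicator (.of_discrete),
      lintegral_fintype, lintegral_fintype]
    simp only [e, hc, ← Finset.sum_mul]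
    congr 1
    rw [Finset.sum_comm]
    refine Finset.sum_congr rfl fun x _ => Finset.sum_congr rfl fun y _ => ?_
    by_cases h : x ∈ B ∧ y ∈ A ∧ H.Adj x y
    · have h' : y ∈ A ∧ x ∈ B ∧ H.Adj y x := ⟨h.2.1, h.1, h.2.2.symm⟩
      simp [Set.indicator, h, h']
    · have h' : ¬(y ∈ A ∧ x ∈ B ∧ H.Adj y x) := fun k => h ⟨k.2.1, k.1, k.2.2.symm⟩
      simp [Set.indicator, h, h']

/-- The rank of the edge set `X` in the cycle matroid: the maximum number of edges of a forest
contained in the graph with edge set `X` (intended for graphs on a finite node set). -/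
noncomputable def cycleMatroidRank {V : Type*} (X : Set (V × V)) : ℕ :=
  sSup {n | ∃ F : SimpleGraph V, F ≤ edgeGraph X ∧ F.IsAcyclic ∧ F.edgeSet.ncard = n}

section SetFunctions

variable {α : Type*} (𝓢 : Set (Set α)) (g : Set α → ℝ)

/-- The setfunction `g` is increasing on the family `𝓢`. -/
def IncreasingOn : Prop := ∀ X ∈ 𝓢, ∀ Y ∈ 𝓢, X ⊆ Y → g X ≤ g Y

/-- The setfunction `g` is submodular on the family `𝓢`. -/
def SubmodularOn : Prop := ∀ X ∈ 𝓢, ∀ Y ∈ 𝓢, g (X ∪ Y) + g (X ∩ Y) ≤ g X + g Y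

/-- The setfunction `g` is nonnegative and bounded above by a finite measure on the family `𝓢`. -/
def StronglyBoundedOn [MeasurableSpace α] : Prop :=
  (∀ X ∈ 𝓢, 0 ≤ g X) ∧ ∃ μ : Measure α, IsFiniteMeasure μ ∧ ∀ X ∈ 𝓢, g X ≤ μ.real X

/-- `g (A n) → g (⋂ n, A n)` for every decreasing sequence `A` of sets in the family `𝓢`. -/
def ContinuousFromAboveOn : Prop :=
  ∀ A : ℕ → Set α, (∀ n, A n ∈ 𝓢) → Antitone A →
    Tendsto (fun n => g (A n)) atTop (𝓝 (g (⋂ n, A n)))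

/-- For every `ε > 0` there is a `δ > 0` such that `|g S| < ε` for all `S ∈ 𝓢` with `μ S < δ`. -/
def AbsContOn [MeasurableSpace α] (μ : Measure α) : Prop :=
  ∀ ε : ℝ, 0 < ε → ∃ δ : ℝ, 0 < δ ∧ ∀ S ∈ 𝓢, μ S < ENNReal.ofReal δ → |g S| < ε

end SetFunctions

/-!
The integral of `1 / |X_u|` is the number of finite components of `(J, X)` per node, called
`componentDensity X` below, so that `ρ = 1 - componentDensity`.

*Measurability.* A Borel graph of bounded degree is covered by countably many Borel maps
(`exists_countable_measurable_cover`, from the Lusin–Souslin theorem applied to increasing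
enumerations of neighborhoods). Composing these maps enumerates each component of `G` in a Borel
way, hence quantifying or summing over a component preserves measurability.

*Mass transport.* The hypothesis `∫_A deg_B = ∫_B deg_A` says that the edge measure is invariant
under swapping coordinates. By composing edges this extends to all pairs of nodes in a common
component (`mass_transport`). It follows that a Borel set meeting each component of `(J, X)` at most
once has measure at most `componentDensity X`, and one meeting each finite component has measure at
least `componentDensity X`.

*Submodularity.* This is the main point, since `X` need not be an increasing union of Borel
subgraphs with finite components. Let `p` be an injective Borel potential with values in a linear
order. Let `P`, `Q` be the sets of nodes where `p` is minimal within the `X`-component and the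
`Y`-component, respectively, and let `A` be the set of local minima of `p` in the graph
`X ∪ Y`. At a node of `Q \ A` the potential decreases along some edge, which must be in `X`; so `P`
and `Q \ A` are disjoint, and `P ∪ Q \ A` meets each component of `X ∩ Y` at most once. Hence the
densities of `X` and `Y` add up to at most the density of `X ∩ Y` plus the measure of `A`
(`componentDensity_add_le_add_measure`). Given an
injective Borel function `f` and a radius `R`, there is a potential whose local minima are minima of
`f` over their `R`-balls (`exists_potential`): order the nodes by the minimum of `f` over the
`R`-ball, then by the distance to that minimum. As `R → ∞`, these sets decrease to the minima of `f`
over whole components of `X ∪ Y`, a set that meets each component at most once and so has measure at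
most the density of `X ∪ Y`.

*The remaining claims.* Continuity from above holds because a finite component of `⋂ A n` is a
component of `A n` for large `n`, and then by dominated convergence. The bound by a multiple of the
edge measure holds because a node with `|X_u| > 1` is incident to a pair in `X`. For a finite graph,
`componentDensity X` is the number of components divided by `|V|`, and the rank of `X` is `|V|`
minus the number of components.
-/

/-! ### Borel enumeration of relations with bounded sections -/

section Enumeration

variable {J : Type*}

/-- The pairs `(x, a)` such that `a` is a `k`-tuple of points in the section of `S` at `x` on which
`f` is strictly increasing. -/
def increasingTuples (S : Set (J × J)) (f : J → ℝ) (k : ℕ) : Set (J × (Fin k → J)) :=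
  {q | (∀ i, (q.1, q.2 i) ∈ S) ∧ ∀ i j, i < j → f (q.2 i) < f (q.2 j)}

lemma range_eq_section_of_mem_increasingTuples {S : Set (J × J)} {f : J → ℝ} {k : ℕ}
    (h : ∀ x, {y | (x, y) ∈ S}.encard ≤ k) {q : J × (Fin k → J)}
    (hq : q ∈ increasingTuples S f k) : Set.range q.2 = {y | (q.1, y) ∈ S} := by
  have hmono : StrictMono (f ∘ q.2) := fun i j hij => hq.2 i j hij
  have hinj : Function.Injective q.2 := hmono.injective.of_comp
  have hcard : (Set.range q.2).encard = k := by
    rw [← Set.image_univ, hinj.encard_image, Set.encard_univ]; simp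
  refine (Set.finite_range q.2).eq_of_subset_of_encard_le ?_ ?_
  · rintro _ ⟨i, rfl⟩; exact hq.1 i
  · rw [hcard]; exact h q.1

lemma eq_of_mem_increasingTuples {S : Set (J × J)} {f : J → ℝ} (hf : Function.Injective f) {k : ℕ}
    (h : ∀ x, {y | (x, y) ∈ S}.encard ≤ k) {x : J} {a b : Fin k → J}
    (ha : (x, a) ∈ increasingTuples S f k) (hb : (x, b) ∈ increasingTuples S f k) : a = b := by
  have ma : StrictMono (f ∘ a) := fun i j hij => ha.2 i j hij
  have mb : StrictMono (f ∘ b) := fun i j hij => hb.2 i j hij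
  have : f ∘ a = f ∘ b := by
    refine (StrictMono.range_inj ma mb).1 ?_
    rw [Set.range_comp, Set.range_comp]
    exact congrArg _ ((range_eq_section_of_mem_increasingTuples h ha).trans
      (range_eq_section_of_mem_increasingTuples h hb).symm)
  exact funext fun i => hf (congrFun this i)

variable [MeasurableSpace J]

lemma measurableSet_increasingTuples {S : Set (J × J)} (hS : MeasurableSet S) {f : J → ℝ}
    (hf : Measurable f) (k : ℕ) : MeasurableSet (increasingTuples S f k) := by
  have : increasingTuples S f k = (⋂ i, {q | (q.1, q.2 i) ∈ S}) ∩
      ⋂ i, ⋂ j, ⋂ (_ : i < j), {q | f (q.2 i) < f (q.2 j)} := by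
    ext q; simp [increasingTuples]
  rw [this]
  refine (MeasurableSet.iInter fun i => ?_).inter
    (.iInter fun i => .iInter fun j => .iInter fun _ => ?_)
  · exact (measurable_fst.prodMk ((measurable_pi_apply i).comp measurable_snd)) hS
  · exact measurableSet_lt (hf.comp ((measurable_pi_apply i).comp measurable_snd))
      (hf.comp ((measurable_pi_apply j).comp measurable_snd))

variable [StandardBorelSpace J]

/-- When all sections of `S` have at most `k` points, a point admits at most one increasing
`k`-tuple in its section, so the Lusin–Souslin theorem shows that Borel sets of such tuples have
Borel projections. -/
lemma measurableSet_image_fst_increasingTuples {S : Set (J × J)} {f : J → ℝ}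
    (hf : Function.Injective f) {k : ℕ} (h : ∀ x, {y | (x, y) ∈ S}.encard ≤ k)
    {T : Set (J × (Fin k → J))} (hT : MeasurableSet T) (hTS : T ⊆ increasingTuples S f k) :
    MeasurableSet (Prod.fst '' T) := by
  refine hT.image_of_measurable_injOn measurable_fst ?_
  rintro ⟨x, a⟩ ha ⟨x', b⟩ hb (rfl : x = x')
  rw [eq_of_mem_increasingTuples hf h (hTS ha) (hTS hb)]

/-- A Borel relation with sections of bounded size is covered by the graphs of countably many
Borel maps. -/
theorem exists_countable_measurable_cover {S : Set (J × J)} (hS : MeasurableSet S) (k : ℕ)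
    (h : ∀ x, {y | (x, y) ∈ S}.encard ≤ k) :
    ∃ Φ : Set (J → J), Φ.Countable ∧ (∀ φ ∈ Φ, Measurable φ) ∧
      ∀ x y, (x, y) ∈ S → ∃ φ ∈ Φ, φ x = y := by
  classical
  obtain ⟨f, hf⟩ := exists_measurableEmbedding_real J
  induction k generalizing S with
  | zero =>
    refine ⟨∅, Set.countable_empty, by simp, fun x y hxy => ?_⟩
    have := h x
    simp only [Nat.cast_zero, nonpos_iff_eq_zero, Set.encard_eq_zero] at this
    exact absurd hxy (by simpa using Set.eq_empty_iff_forall_notMem.1 this y)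
  | succ k ih =>
    -- over the points whose section has exactly `k + 1` elements, the entries of the unique
    -- increasing tuple are Borel functions; elsewhere the sections have at most `k` elements
    set T := increasingTuples S f (k + 1)
    have hT : MeasurableSet T := measurableSet_increasingTuples hS hf.measurable _
    have hfst : MeasurableSet (Prod.fst '' T) :=
      measurableSet_image_fst_increasingTuples hf.injective h hT subset_rfl
    have hex : ∀ x ∈ Prod.fst '' T, ∃ a, (x, a) ∈ T := by
      rintro _ ⟨⟨x, a⟩, ha, rfl⟩; exact ⟨a, ha⟩
    choose! a ha using hex
    have huniq : ∀ x b, (x, b) ∈ T → b = a x := fun x b hb =>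
      eq_of_mem_increasingTuples hf.injective h hb (ha x ⟨_, hb, rfl⟩)
    let φ : Fin (k + 1) → J → J := fun i x => if x ∈ Prod.fst '' T then a x i else x
    have hφ : ∀ i, Measurable (φ i) := by
      intro i B hB
      have : φ i ⁻¹' B = Prod.fst '' (T ∩ {q | q.2 i ∈ B}) ∪ ((Prod.fst '' T)ᶜ ∩ B) := by
        ext x
        by_cases hx : x ∈ Prod.fst '' T
        · have e : φ i x = a x i := if_pos hx
          simp only [Set.mem_preimage, e, Set.mem_union, Set.mem_inter_iff, Set.mem_compl_iff, hx,
            not_true_eq_false, false_and, or_false]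
          constructor
          · intro hB'
            exact ⟨(x, a x), ⟨ha x hx, hB'⟩, rfl⟩
          · rintro ⟨⟨x', b⟩, ⟨hb, hbB⟩, rfl⟩
            rw [← huniq _ _ hb]; exact hbB
        · have e : φ i x = x := if_neg hx
          have hx' : x ∉ Prod.fst '' (T ∩ {q | q.2 i ∈ B}) :=
            fun h => hx (Set.image_mono Set.inter_subset_left h)
          simp only [Set.mem_preimage, e, Set.mem_union, Set.mem_inter_iff, Set.mem_compl_iff, hx,
            not_false_eq_true, true_and, hx', false_or]
      rw [this]
      refine .union (measurableSet_image_fst_increasingTuples hf.injective h (hT.inter ?_)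
        Set.inter_subset_left) (hfst.compl.inter hB)
      exact ((measurable_pi_apply i).comp measurable_snd) hB
    have hS' : MeasurableSet (S \ (Prod.fst ⁻¹' (Prod.fst '' T))) :=
      hS.diff (measurable_fst hfst)
    obtain ⟨Φ, hΦc, hΦm, hΦ⟩ := ih hS' (by
      intro x
      by_cases hx : x ∈ Prod.fst '' T
      · have : {y | (x, y) ∈ S \ (Prod.fst ⁻¹' (Prod.fst '' T))} = ∅ := by
          ext y
          exact iff_of_false (fun hy => hy.2 hx) (Set.notMem_empty y)
        rw [this]; simp
      · refine (Set.encard_le_encard (t := {y | (x, y) ∈ S}) fun y hy => hy.1).trans ?_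
        by_contra hlt
        have hle : ((k + 1 : ℕ) : ℕ∞) ≤ (f '' {y | (x, y) ∈ S}).encard := by
          rw [hf.injective.encard_image]
          push_cast
          exact Order.add_one_le_of_lt (not_le.1 hlt)
        obtain ⟨t, hts, htc⟩ := Set.exists_subset_encard_eq hle
        have htf : t.Finite := Set.finite_of_encard_eq_coe htc
        have hc : htf.toFinset.card = k + 1 := by
          rw [← Set.ncard_eq_toFinset_card _ htf, Set.ncard, htc]; simp
        have key : ∀ i, ∃ y, (x, y) ∈ S ∧ f y = htf.toFinset.orderEmbOfFin hc i := fun i =>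
          hts (htf.mem_toFinset.1 (Finset.orderEmbOfFin_mem _ hc i))
        choose b hb1 hb2 using key
        refine hx ⟨(x, b), ⟨hb1, fun i j hij => ?_⟩, rfl⟩
        simp only [hb2]
        exact (htf.toFinset.orderEmbOfFin hc).strictMono hij)
    refine ⟨Φ ∪ Set.range φ, hΦc.union (Set.countable_range φ), ?_, fun x y hxy => ?_⟩
    · rintro ψ (hψ | ⟨i, rfl⟩)
      · exact hΦm ψ hψ
      · exact hφ i
    · by_cases hx : x ∈ Prod.fst '' T
      · have hr := range_eq_section_of_mem_increasingTuples h (ha x hx)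
        obtain ⟨i, hi⟩ : y ∈ Set.range (a x) := by
          simp only at hr; rw [hr]; exact hxy
        exact ⟨φ i, .inr ⟨i, rfl⟩, by rw [← hi]; exact if_pos hx⟩
      · obtain ⟨ψ, hψ, e⟩ := hΦ x y ⟨hxy, hx⟩
        exact ⟨ψ, .inl hψ, e⟩

/-- A sum over all points whose support is covered by countably many Borel maps depends measurably
on the parameter. -/
lemma measurable_tsum_of_cover {α : Type*} [MeasurableSpace α] {ψ : ℕ → α → J}
    (hψ : ∀ n, Measurable (ψ n)) {F : α → J → ℝ≥0∞} (hF : Measurable (Function.uncurry F))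
    (hsupp : ∀ a y, F a y ≠ 0 → ∃ n, ψ n a = y) : Measurable fun a => ∑' y, F a y := by
  classical
  -- the `n`-th term counts the value `ψ n a` when it occurs for the first time
  have key : ∀ a, ∑' y, F a y =
      ∑' n, if ∀ m < n, ψ m a ≠ ψ n a then F a (ψ n a) else 0 := by
    intro a
    have h1 : ∀ y, F a y =
        ∑' n, if (∀ m < n, ψ m a ≠ ψ n a) ∧ ψ n a = y then F a y else 0 := by
      intro y
      by_cases h0 : F a y = 0
      · simp [h0]
      have hex := hsupp a y h0
      rw [tsum_eq_single (Nat.find hex)]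
      · rw [if_pos]
        refine ⟨fun m hm => ?_, Nat.find_spec hex⟩
        rw [Nat.find_spec hex]; exact Nat.find_min hex hm
      · intro n hn
        refine if_neg fun ⟨hmin, he⟩ => ?_
        rcases lt_trichotomy n (Nat.find hex) with h | h | h
        · exact Nat.find_min hex h he
        · exact hn h
        · exact hmin _ h (by rw [he]; exact Nat.find_spec hex)
    calc ∑' y, F a y = ∑' y, ∑' n, if (∀ m < n, ψ m a ≠ ψ n a) ∧ ψ n a = y then F a y else 0 :=
          tsum_congr h1
      _ = ∑' n, ∑' y, if (∀ m < n, ψ m a ≠ ψ n a) ∧ ψ n a = y then F a y else 0 :=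
          ENNReal.tsum_comm
      _ = _ := by
        refine tsum_congr fun n => ?_
        rw [tsum_eq_single (ψ n a)]
        · simp
        · intro y hy
          exact if_neg fun h => hy h.2.symm
  simp_rw [key]
  refine Measurable.tsum fun n => Measurable.ite ?_ ?_ measurable_const
  · have : {a | ∀ m < n, ψ m a ≠ ψ n a} = ⋂ m, ⋂ (_ : m < n), {a | ψ m a = ψ n a}ᶜ := by
      ext a; simp
    rw [this]
    exact .iInter fun m => .iInter fun _ => (measurableSet_eq_fun (hψ m) (hψ n)).compl
  · exact hF.comp (measurable_id.prodMk (hψ n))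

end Enumeration

/-! ### Balls and components of Borel subgraphs -/

section EdgeBall

variable {J : Type*}

lemma setSize_eq_tsum (s : Set J) : setSize s = ∑' y, s.indicator (fun _ => (1 : ℝ≥0∞)) y := by
  rw [← tsum_subtype, ENNReal.tsum_set_one]; rfl

lemma setSize_mono {s t : Set J} (h : s ⊆ t) : setSize s ≤ setSize t :=
  ENat.toENNReal_le.2 (Set.encard_le_encard h)

lemma setSize_eq_top {s : Set J} : setSize s = ∞ ↔ s.Infinite := by
  simp [setSize]

lemma setSize_ne_zero {s : Set J} (h : s.Nonempty) : setSize s ≠ 0 := by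
  simpa [setSize, Set.nonempty_iff_ne_empty] using h

lemma edgeGraph_mono {X Y : Set (J × J)} (h : X ⊆ Y) : edgeGraph X ≤ edgeGraph Y := by
  intro x y hxy
  simp only [edgeGraph, SimpleGraph.fromRel_adj] at hxy ⊢
  exact ⟨hxy.1, hxy.2.imp (fun a => h a) (fun a => h a)⟩

lemma mem_componentOf_self (X : Set (J × J)) (x : J) : x ∈ componentOf X x :=
  SimpleGraph.Reachable.refl x

lemma componentOf_mono {X Y : Set (J × J)} (h : X ⊆ Y) (x : J) :
    componentOf X x ⊆ componentOf Y x :=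
  fun _ hy => SimpleGraph.Reachable.mono (edgeGraph_mono h) hy

lemma mem_componentOf_comm {X : Set (J × J)} {x y : J} :
    y ∈ componentOf X x ↔ x ∈ componentOf X y :=
  SimpleGraph.reachable_comm

lemma componentOf_eq_of_mem {X : Set (J × J)} {x y : J} (h : y ∈ componentOf X x) :
    componentOf X y = componentOf X x :=
  Set.ext fun _ => ⟨fun hz => SimpleGraph.Reachable.trans h hz,
    fun hz => SimpleGraph.Reachable.trans (SimpleGraph.Reachable.symm h) hz⟩

lemma mem_componentOf_of_adj {X : Set (J × J)} {x y : J} (h : (edgeGraph X).Adj x y) :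
    y ∈ componentOf X x :=
  h.reachable

/-- The pairs of nodes at distance at most `n` in the graph with edge set `X`. -/
def edgeBall (X : Set (J × J)) : ℕ → Set (J × J)
  | 0 => Set.diagonal J
  | n + 1 => edgeBall X n ∪ {p | ∃ y, (edgeGraph X).Adj p.1 y ∧ (y, p.2) ∈ edgeBall X n}

lemma edgeBall_mono (X : Set (J × J)) : Monotone (edgeBall X) :=
  monotone_nat_of_le_succ fun _ => Set.subset_union_left

lemma mem_edgeBall_self (X : Set (J × J)) (n : ℕ) (x : J) : (x, x) ∈ edgeBall X n :=
  edgeBall_mono X n.zero_le (Set.mem_diagonal x)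

lemma mem_componentOf_iff {X : Set (J × J)} {x y : J} :
    y ∈ componentOf X x ↔ ∃ n, (x, y) ∈ edgeBall X n := by
  constructor
  · rintro ⟨w⟩
    induction w with
    | nil => exact ⟨0, Set.mem_diagonal _⟩
    | cons h _ ih =>
      obtain ⟨n, hn⟩ := ih
      exact ⟨n + 1, .inr ⟨_, h, hn⟩⟩
  · rintro ⟨n, hn⟩
    induction n generalizing x with
    | zero =>
      obtain rfl : x = y := hn
      exact mem_componentOf_self X x
    | succ n ih =>
      rcases hn with hn | ⟨z, hxz, hz⟩
      · exact ih hn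
      · exact hxz.reachable.trans (ih hz)

end EdgeBall

namespace Graphing

variable {J : Type*} [MeasurableSpace J] [StandardBorelSpace J] (G : Graphing J)

lemma edgeGraph_adj_iff {x y : J} : (edgeGraph G.E).Adj x y ↔ (x, y) ∈ G.E := by
  simp only [edgeGraph, SimpleGraph.fromRel_adj]
  refine ⟨fun h => h.2.elim id (G.symm_E _ _), fun h => ⟨?_, .inl h⟩⟩
  rintro rfl
  exact G.irrefl_E _ h

variable {G} in
lemma mem_E_of_adj {X : Set (J × J)} (hX : X ⊆ G.E) {x y : J} (h : (edgeGraph X).Adj x y) :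
    (x, y) ∈ G.E :=
  G.edgeGraph_adj_iff.1 (edgeGraph_mono hX h)

lemma finite_neighbors (x : J) : {y | (x, y) ∈ G.E}.Finite := by
  obtain ⟨D, hD⟩ := G.exists_degree_le
  refine Set.not_infinite.1 fun h => ?_
  have := hD x
  rw [setSize_eq_top.2 h] at this
  exact absurd this (by simp)

variable {G} in
lemma finite_edgeBall {X : Set (J × J)} (hX : X ⊆ G.E) (n : ℕ) (x : J) :
    {y | (x, y) ∈ edgeBall X n}.Finite := by
  induction n generalizing x with
  | zero => exact (Set.finite_singleton x).subset fun y (hy : x = y) => hy.symm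
  | succ n ih =>
    refine ((ih x).union ((G.finite_neighbors x).biUnion fun y _ => ih y)).subset ?_
    rintro z (hz | ⟨y, hxy, hz⟩)
    · exact .inl hz
    · exact .inr (Set.mem_biUnion (mem_E_of_adj hX hxy : y ∈ {y | (x, y) ∈ G.E}) hz)

/-- Countably many Borel maps enumerate every component of a graphing. -/
theorem exists_enumeration : ∃ φ : ℕ → J → J, (∀ n, Measurable (φ n)) ∧
    ∀ x, ∀ y ∈ componentOf G.E x, ∃ n, φ n x = y := by
  obtain ⟨D, hD⟩ := G.exists_degree_le
  obtain ⟨Φ, hΦc, hΦm, hΦ⟩ := exists_countable_measurable_cover G.measurableSet_E D (fun x => by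
    have := hD x
    unfold setSize at this
    exact ENat.toENNReal_le.1 (by simpa using this))
  obtain ⟨σ, hσ⟩ := (hΦc.insert id).exists_eq_range ⟨id, Set.mem_insert _ _⟩
  have hσm : ∀ i, Measurable (σ i) := fun i => by
    have : σ i ∈ insert id Φ := hσ ▸ Set.mem_range_self i
    rcases this with h | h
    · rw [h]; exact measurable_id
    · exact hΦm _ h
  have hσE : ∀ x y, (x, y) ∈ G.E → ∃ i, σ i x = y := fun x y h => by
    obtain ⟨ψ, hψ, e⟩ := hΦ x y h
    obtain ⟨i, rfl⟩ : ψ ∈ Set.range σ := hσ ▸ Set.mem_insert_of_mem _ hψ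
    exact ⟨i, e⟩
  -- words in the generators `σ i` reach the whole component
  let word : List ℕ → J → J := fun w x => w.foldl (fun z i => σ i z) x
  have hword : ∀ w, Measurable (word w) := by
    intro w
    induction w with
    | nil => exact measurable_id
    | cons i w ih => exact ih.comp (hσm i)
  have hreach : ∀ n x y, (x, y) ∈ edgeBall G.E n → ∃ w, word w x = y := by
    intro n
    induction n with
    | zero => exact fun x y h => ⟨[], h⟩
    | succ n ih =>
      rintro x y (h | ⟨z, hxz, hz⟩)
      · exact ih x y h
      · obtain ⟨i, rfl⟩ := hσE x z (G.edgeGraph_adj_iff.1 hxz)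
        obtain ⟨w, hw⟩ := ih _ _ hz
        exact ⟨i :: w, hw⟩
  refine ⟨fun n => word (Denumerable.ofNat (List ℕ) n), fun n => hword _, fun x y hy => ?_⟩
  obtain ⟨n, hn⟩ := mem_componentOf_iff.1 hy
  obtain ⟨w, hw⟩ := hreach n x y hn
  exact ⟨Encodable.encode w, by simpa using hw⟩

/-- Quantification over a component of a graphing preserves Borel measurability. -/
lemma measurableSet_exists {α : Type*} [MeasurableSpace α] {h : α → J} (hh : Measurable h)
    {Q : Set (α × J)} (hQ : MeasurableSet Q)
    (hsupp : ∀ a y, (a, y) ∈ Q → y ∈ componentOf G.E (h a)) :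
    MeasurableSet {a | ∃ y, (a, y) ∈ Q} := by
  obtain ⟨φ, hφm, hφ⟩ := G.exists_enumeration
  have : {a | ∃ y, (a, y) ∈ Q} = ⋃ n, {a | (a, φ n (h a)) ∈ Q} := by
    ext a
    simp only [Set.mem_ofPred_eq, Set.mem_iUnion]
    refine ⟨fun ⟨y, hy⟩ => ?_, fun ⟨n, hn⟩ => ⟨_, hn⟩⟩
    obtain ⟨n, rfl⟩ := hφ _ y (hsupp a y hy)
    exact ⟨n, hy⟩
  rw [this]
  exact .iUnion fun n => (measurable_id.prodMk ((hφm n).comp hh)) hQ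

/-- Summation over a component of a graphing preserves Borel measurability. -/
lemma measurable_tsum {α : Type*} [MeasurableSpace α] {h : α → J} (hh : Measurable h)
    {F : α → J → ℝ≥0∞} (hF : Measurable (Function.uncurry F))
    (hsupp : ∀ a y, F a y ≠ 0 → y ∈ componentOf G.E (h a)) : Measurable fun a => ∑' y, F a y := by
  obtain ⟨φ, hφm, hφ⟩ := G.exists_enumeration
  exact measurable_tsum_of_cover (fun n => (hφm n).comp hh) hF
    fun a y ha => hφ _ y (hsupp a y ha)

lemma measurableSet_adj {X : Set (J × J)} (hX : MeasurableSet X) :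
    MeasurableSet {p : J × J | (edgeGraph X).Adj p.1 p.2} := by
  have : {p : J × J | (edgeGraph X).Adj p.1 p.2} =
      (Set.diagonal J)ᶜ ∩ (X ∪ Prod.swap ⁻¹' X) := by
    ext ⟨x, y⟩; simp [edgeGraph]
  rw [this]
  exact measurableSet_diagonal.compl.inter (hX.union (measurable_swap hX))

variable {G} in
lemma measurableSet_edgeBall {X : Set (J × J)} (hX : X ∈ G.borelEdgeSets) (n : ℕ) :
    MeasurableSet (edgeBall X n) := by
  induction n with
  | zero => exact measurableSet_diagonal
  | succ n ih =>
    refine ih.union (G.measurableSet_exists (h := Prod.fst) measurable_fst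
      (Q := {q : (J × J) × J | (edgeGraph X).Adj q.1.1 q.2 ∧ (q.2, q.1.2) ∈ edgeBall X n}) ?_ ?_)
    · exact MeasurableSet.inter
        (((measurable_fst.comp measurable_fst).prodMk measurable_snd) (measurableSet_adj hX.1))
        ((measurable_snd.prodMk (measurable_snd.comp measurable_fst)) ih)
    · intro a y h
      exact componentOf_mono hX.2 _ (mem_componentOf_of_adj h.1)

variable {G} in
lemma measurableSet_componentOf {X : Set (J × J)} (hX : X ∈ G.borelEdgeSets) :
    MeasurableSet {p : J × J | p.2 ∈ componentOf X p.1} := by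
  simp_rw [mem_componentOf_iff, Set.ofPred_exists]
  exact .iUnion fun n => measurableSet_edgeBall hX n

variable {G} in
lemma measurable_setSize_componentOf {X : Set (J × J)} (hX : X ∈ G.borelEdgeSets) :
    Measurable fun x => setSize (componentOf X x) := by
  simp_rw [setSize_eq_tsum]
  refine G.measurable_tsum (h := id) measurable_id ?_ fun x y h =>
    componentOf_mono hX.2 _ (Set.mem_of_indicator_ne_zero h)
  exact (measurable_const (a := (1 : ℝ≥0∞))).indicator (measurableSet_componentOf hX)

variable {G} in
theorem measurable_invComponentSize {X : Set (J × J)} (hX : X ∈ G.borelEdgeSets) :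
    Measurable (invComponentSize X) :=
  (measurable_setSize_componentOf hX).inv

end Graphing

/-! ### The mass transport principle -/

namespace Graphing

variable {J : Type*} [MeasurableSpace J] [StandardBorelSpace J] (G : Graphing J)

instance : IsProbabilityMeasure G.lam := G.isProbabilityMeasure_lam

/-- The edge measure of a graphing before normalization by the average degree. -/
noncomputable def adjMeasure : Measure (J × J) :=
  G.lam.bind fun x => Measure.sum fun y : {y : J // (x, y) ∈ G.E} => Measure.dirac (x, y.1)

lemma edgeMeasure_eq : G.edgeMeasure = G.avgDegree⁻¹ • G.adjMeasure := rfl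

variable {G} in
lemma mem_componentOf_of_indicator_ne_zero {F : J × J → ℝ≥0∞} {x y : J}
    (h : G.E.indicator F (x, y) ≠ 0) : y ∈ componentOf G.E x :=
  mem_componentOf_of_adj (G.edgeGraph_adj_iff.2 (Set.mem_of_indicator_ne_zero h))

lemma lintegral_sum_dirac {F : J × J → ℝ≥0∞} (hF : Measurable F) (x : J) :
    ∫⁻ p, F p ∂(Measure.sum fun y : {y : J // (x, y) ∈ G.E} => Measure.dirac (x, y.1)) =
      ∑' y, G.E.indicator F (x, y) := by
  rw [lintegral_sum_measure]
  simp_rw [lintegral_dirac' _ hF]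
  exact tsum_subtype {y | (x, y) ∈ G.E} fun y => F (x, y)

lemma measurable_sum_dirac : Measurable fun x =>
    Measure.sum fun y : {y : J // (x, y) ∈ G.E} => Measure.dirac (x, y.1) := by
  refine Measure.measurable_of_measurable_coe _ fun S hS => ?_
  have hm : Measurable (S.indicator (1 : J × J → ℝ≥0∞)) := measurable_one.indicator hS
  have : ∀ x, (Measure.sum fun y : {y : J // (x, y) ∈ G.E} => Measure.dirac (x, y.1)) S =
      ∑' y, G.E.indicator (S.indicator 1) (x, y) := fun x => by
    rw [← lintegral_indicator_one hS, G.lintegral_sum_dirac hm]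
  simp_rw [this]
  exact G.measurable_tsum (h := id) measurable_id (hm.indicator G.measurableSet_E)
    fun _ _ => mem_componentOf_of_indicator_ne_zero

lemma lintegral_adjMeasure {F : J × J → ℝ≥0∞} (hF : Measurable F) :
    ∫⁻ p, F p ∂G.adjMeasure = ∫⁻ x, ∑' y, G.E.indicator F (x, y) ∂G.lam := by
  rw [adjMeasure, Measure.lintegral_bind G.measurable_sum_dirac.aemeasurable hF.aemeasurable]
  exact lintegral_congr fun x => G.lintegral_sum_dirac hF x

lemma adjMeasure_apply {S : Set (J × J)} (hS : MeasurableSet S) :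
    G.adjMeasure S = ∫⁻ x, setSize {y | (x, y) ∈ S ∧ (x, y) ∈ G.E} ∂G.lam := by
  rw [← lintegral_indicator_one hS, G.lintegral_adjMeasure (measurable_one.indicator hS)]
  refine lintegral_congr fun x => ?_
  rw [setSize_eq_tsum]
  refine tsum_congr fun y => ?_
  by_cases h1 : (x, y) ∈ S <;> by_cases h2 : (x, y) ∈ G.E <;> simp [h1, h2]

lemma adjMeasure_prod {A B : Set J} (hA : MeasurableSet A) (hB : MeasurableSet B) :
    G.adjMeasure (A ×ˢ B) = ∫⁻ x in A, G.degTo B x ∂G.lam := by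
  rw [G.adjMeasure_apply (hA.prod hB), ← lintegral_indicator hA]
  refine lintegral_congr fun x => ?_
  by_cases hx : x ∈ A
  · simp [hx, degTo]
  · simp [hx, setSize]

lemma adjMeasure_univ : G.adjMeasure Set.univ = G.avgDegree := by
  rw [← Set.univ_prod_univ, G.adjMeasure_prod .univ .univ, avgDegree, Measure.restrict_univ]

lemma avgDegree_ne_top : G.avgDegree ≠ ∞ := by
  obtain ⟨D, hD⟩ := G.exists_degree_le
  refine ne_top_of_le_ne_top (ENNReal.natCast_ne_top D) ?_
  calc G.avgDegree ≤ ∫⁻ _, D ∂G.lam := lintegral_mono fun x => by simpa [degTo] using hD x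
    _ = D := by simp

instance : IsFiniteMeasure G.adjMeasure :=
  ⟨by rw [adjMeasure_univ]; exact G.avgDegree_ne_top.lt_top⟩

/-- Reversing edges preserves the edge measure: it does so on rectangles. -/
lemma map_swap_adjMeasure : G.adjMeasure.map Prod.swap = G.adjMeasure := by
  refine (ext_of_generate_finite _ generateFrom_prod.symm isPiSystem_prod ?_ ?_).symm
  · rintro _ ⟨A, hA, B, hB, rfl⟩
    rw [Measure.map_apply measurable_swap (hA.prod hB), Set.preimage_swap_prod,
      G.adjMeasure_prod hA hB, G.adjMeasure_prod hB hA]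
    exact G.measure_preserving A B hA hB
  · rw [Measure.map_apply measurable_swap .univ, Set.preimage_univ]

/-- Mass transport along the pairs of the relation `R` preserves total mass. -/
def TransportsMass (R : Set (J × J)) : Prop :=
  ∀ F : J → J → ℝ≥0∞, Measurable (Function.uncurry F) → (∀ x y, F x y ≠ 0 → (x, y) ∈ R) →
    ∫⁻ x, ∑' y, F x y ∂G.lam = ∫⁻ y, ∑' x, F x y ∂G.lam

lemma transportsMass_E : G.TransportsMass G.E := by
  intro F hF hsupp
  have h : ∀ p, G.E.indicator (Function.uncurry F) p = F p.1 p.2 := by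
    rintro ⟨x, y⟩
    by_cases h0 : F x y = 0
    · simp [Set.indicator, h0]
    · simp [Set.indicator, hsupp x y h0]
  have h' : ∀ p, G.E.indicator (Function.uncurry F ∘ Prod.swap) p = F p.2 p.1 := by
    rintro ⟨x, y⟩
    by_cases h0 : F y x = 0
    · simp [Set.indicator, h0]
    · simp [Set.indicator, G.symm_E _ _ (hsupp y x h0)]
  have e1 := G.lintegral_adjMeasure hF
  have e2 := G.lintegral_adjMeasure (hF.comp measurable_swap)
  simp_rw [h] at e1
  simp_rw [h'] at e2
  rw [← e1, ← e2, ← G.map_swap_adjMeasure, lintegral_map hF measurable_swap,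
    G.map_swap_adjMeasure]
  rfl

lemma transportsMass_diagonal : G.TransportsMass (Set.diagonal J) := by
  intro F _ hsupp
  refine lintegral_congr fun x => ?_
  rw [tsum_eq_single x fun y hy => by_contra fun h => hy (hsupp x y h).symm,
    tsum_eq_single x fun y hy => by_contra fun h => hy (hsupp y x h)]

variable {G} in
/-- Mass can be transported along an edge followed by a pair of `R`: the mass sent from `x` to `z`
is split evenly among the intermediate nodes. -/
lemma TransportsMass.comp {R : Set (J × J)} (h : G.TransportsMass R) (hR : MeasurableSet R)
    (hRE : ∀ x y, (x, y) ∈ R → y ∈ componentOf G.E x) :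
    G.TransportsMass {p | ∃ y, (p.1, y) ∈ G.E ∧ (y, p.2) ∈ R} := by
  intro F hF hsupp
  have hmE : ∀ x y, (x, y) ∈ G.E → y ∈ componentOf G.E x := fun x y hxy =>
    mem_componentOf_of_adj (G.edgeGraph_adj_iff.2 hxy)
  let M : Set (J × J × J) := {q | (q.1, q.2.1) ∈ G.E ∧ (q.2.1, q.2.2) ∈ R}
  have hM : MeasurableSet M :=
    ((measurable_fst.prodMk (measurable_fst.comp measurable_snd)) G.measurableSet_E).inter
      (measurable_snd hR)
  let W : J → J → J → ℝ≥0∞ := fun x y z => M.indicator 1 (x, y, z)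
  have hW : Measurable fun q : J × J × J => W q.1 q.2.1 q.2.2 := measurable_one.indicator hM
  have hW0 : ∀ {x y z}, W x y z ≠ 0 → (x, y) ∈ G.E ∧ (y, z) ∈ R :=
    fun {x y z} h0 => (Set.mem_of_indicator_ne_zero h0 : (x, y, z) ∈ M)
  -- the number of intermediate nodes between `x` and `z`, finite since degrees are finite
  let N : J → J → ℝ≥0∞ := fun x z => ∑' y, W x y z
  have hN : Measurable fun p : J × J => N p.1 p.2 :=
    G.measurable_tsum (h := Prod.fst) measurable_fst
      (hW.comp ((measurable_fst.comp measurable_fst).prodMk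
        (measurable_snd.prodMk (measurable_snd.comp measurable_fst))))
      fun a y h0 => hmE _ _ (hW0 h0).1
  have hNtop : ∀ x z, N x z ≠ ∞ := by
    intro x z
    refine ne_top_of_le_ne_top (b := setSize {y | (x, y) ∈ G.E})
      (fun htop => setSize_eq_top.1 htop (G.finite_neighbors x)) ?_
    rw [setSize_eq_tsum]
    refine ENNReal.tsum_le_tsum fun y => ?_
    by_cases hxy : (x, y) ∈ G.E
    · simp only [W, Set.indicator_of_mem (show y ∈ {y | (x, y) ∈ G.E} from hxy)]
      exact Set.indicator_le_self' (fun _ _ => zero_le) _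
    · have : W x y z = 0 := by_contra fun h0 => hxy (hW0 h0).1
      simp [this]
  have hN0 : ∀ x z, F x z ≠ 0 → N x z ≠ 0 := by
    intro x z h0 hz
    obtain ⟨y, hy⟩ := hsupp x z h0
    have : W x y z = 0 := ENNReal.tsum_eq_zero.1 hz y
    simp [W, M, hy] at this
  let H : J → J → J → ℝ≥0∞ := fun x y z => W x y z * (F x z / N x z)
  have hH : Measurable fun q : J × J × J => H q.1 q.2.1 q.2.2 := by
    have hm : Measurable fun q : J × J × J => (q.1, q.2.2) :=
      measurable_fst.prodMk (measurable_snd.comp measurable_snd)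
    exact hW.mul ((hF.comp hm).div (hN.comp hm))
  have hH0 : ∀ {x y z}, H x y z ≠ 0 → (x, y) ∈ G.E ∧ (y, z) ∈ R := fun h0 =>
    hW0 (left_ne_zero_of_mul h0)
  have hFH : ∀ x z, F x z = ∑' y, H x y z := by
    intro x z
    simp only [H]
    rw [ENNReal.tsum_mul_right]
    by_cases h0 : F x z = 0
    · simp [h0]
    · exact (ENNReal.mul_div_cancel (hN0 x z h0) (hNtop x z)).symm
  have hK1 : Measurable (Function.uncurry fun x y => ∑' z, H x y z) :=
    G.measurable_tsum (α := J × J) (h := Prod.snd) measurable_snd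
      (hH.comp ((measurable_fst.comp measurable_fst).prodMk
        ((measurable_snd.comp measurable_fst).prodMk measurable_snd)))
      fun a z h0 => hRE _ _ (hH0 h0).2
  have hK2 : Measurable (Function.uncurry fun y z => ∑' x, H x y z) :=
    G.measurable_tsum (α := J × J) (h := Prod.fst) measurable_fst
      (hH.comp (measurable_snd.prodMk
        ((measurable_fst.comp measurable_fst).prodMk (measurable_snd.comp measurable_fst))))
      fun a x h0 => mem_componentOf_comm.1 (hmE _ _ (hH0 h0).1)
  have hex : ∀ {f : J → ℝ≥0∞}, ∑' y, f y ≠ 0 → ∃ y, f y ≠ 0 := fun h0 => by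
    by_contra! hall
    exact h0 (ENNReal.tsum_eq_zero.2 hall)
  calc ∫⁻ x, ∑' z, F x z ∂G.lam = ∫⁻ x, ∑' y, ∑' z, H x y z ∂G.lam := by
        refine lintegral_congr fun x => ?_
        simp_rw [hFH x]
        exact ENNReal.tsum_comm
    _ = ∫⁻ y, ∑' x, ∑' z, H x y z ∂G.lam :=
        G.transportsMass_E _ hK1 fun x y h0 => by
          obtain ⟨z, hz⟩ := hex h0
          exact (hH0 hz).1
    _ = ∫⁻ y, ∑' z, ∑' x, H x y z ∂G.lam := lintegral_congr fun y => ENNReal.tsum_comm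
    _ = ∫⁻ z, ∑' y, ∑' x, H x y z ∂G.lam :=
        h _ hK2 fun y z h0 => by
          obtain ⟨x, hx⟩ := hex h0
          exact (hH0 hx).2
    _ = ∫⁻ z, ∑' x, F x z ∂G.lam := by
        refine lintegral_congr fun z => ?_
        simp_rw [fun x => hFH x z]
        exact ENNReal.tsum_comm

variable {G} in
lemma TransportsMass.iUnion {R : ℕ → Set (J × J)} (h : ∀ n, G.TransportsMass (R n))
    (hR : ∀ n, MeasurableSet (R n)) (hRE : ∀ n x y, (x, y) ∈ R n → y ∈ componentOf G.E x) :
    G.TransportsMass (⋃ n, R n) := by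
  intro F hF hsupp
  -- the part of `F` carried by the pairs that occur in `R n` for the first time
  let F' : ℕ → J → J → ℝ≥0∞ := fun n x y =>
    (disjointed R n).indicator (Function.uncurry F) (x, y)
  have hF' : ∀ n, Measurable (Function.uncurry (F' n)) := fun n =>
    hF.indicator (MeasurableSet.disjointed hR n)
  have hF0 : ∀ n x y, F' n x y ≠ 0 → (x, y) ∈ R n := fun n x y h0 =>
    disjointed_subset R n (Set.mem_of_indicator_ne_zero h0)
  have hsum : ∀ x y, F x y = ∑' n, F' n x y := by
    intro x y
    by_cases h0 : F x y = 0
    · rw [h0, eq_comm]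
      refine ENNReal.tsum_eq_zero.2 fun n => ?_
      simp [F', Set.indicator, h0]
    · have hmem : (x, y) ∈ ⋃ n, disjointed R n := iUnion_disjointed (f := R) ▸ hsupp x y h0
      obtain ⟨n, hn⟩ := Set.mem_iUnion.1 hmem
      rw [tsum_eq_single n]
      · simp [F', hn]
      · intro m hm
        refine Set.indicator_of_notMem (fun hm' => ?_) _
        exact Set.disjoint_left.1 (disjoint_disjointed R hm) hm' hn
  have hmeas1 : ∀ n, Measurable fun x => ∑' y, F' n x y := fun n =>
    G.measurable_tsum (h := id) measurable_id (hF' n) fun x y h0 => hRE n x y (hF0 n x y h0)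
  have hmeas2 : ∀ n, Measurable fun y => ∑' x, F' n x y := fun n =>
    G.measurable_tsum (h := id) measurable_id ((hF' n).comp measurable_swap)
      fun y x h0 => mem_componentOf_comm.1 (hRE n x y (hF0 n x y h0))
  calc ∫⁻ x, ∑' y, F x y ∂G.lam = ∑' n, ∫⁻ x, ∑' y, F' n x y ∂G.lam := by
        rw [← lintegral_tsum fun n => (hmeas1 n).aemeasurable]
        refine lintegral_congr fun x => ?_
        simp_rw [hsum x]
        exact ENNReal.tsum_comm
    _ = ∑' n, ∫⁻ y, ∑' x, F' n x y ∂G.lam := tsum_congr fun n => h n _ (hF' n) (hF0 n)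
    _ = ∫⁻ y, ∑' x, F x y ∂G.lam := by
        rw [← lintegral_tsum fun n => (hmeas2 n).aemeasurable]
        refine lintegral_congr fun y => ?_
        simp_rw [fun x => hsum x y]
        exact ENNReal.tsum_comm

/-- The mass transport principle: mass sent within the components of a graphing is preserved. -/
theorem mass_transport {F : J → J → ℝ≥0∞} (hF : Measurable (Function.uncurry F))
    (hsupp : ∀ x y, F x y ≠ 0 → y ∈ componentOf G.E x) :
    ∫⁻ x, ∑' y, F x y ∂G.lam = ∫⁻ y, ∑' x, F x y ∂G.lam := by
  -- `S n` consists of the pairs joined by a walk of length exactly `n`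
  let S : ℕ → Set (J × J) := fun n =>
    n.rec (Set.diagonal J) fun _ R => {p | ∃ y, (p.1, y) ∈ G.E ∧ (y, p.2) ∈ R}
  have hSE : ∀ n x y, (x, y) ∈ S n → y ∈ componentOf G.E x := by
    intro n
    induction n with
    | zero => rintro x y (rfl : x = y); exact mem_componentOf_self _ _
    | succ n ih =>
      rintro x z ⟨y, hxy, hyz⟩
      exact (G.edgeGraph_adj_iff.2 hxy).reachable.trans (ih y z hyz)
  have hSm : ∀ n, MeasurableSet (S n) := by
    intro n
    induction n with
    | zero => exact measurableSet_diagonal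
    | succ n ih =>
      refine G.measurableSet_exists (h := Prod.fst) measurable_fst
        (Q := {q : (J × J) × J | (q.1.1, q.2) ∈ G.E ∧ (q.2, q.1.2) ∈ S n}) ?_ ?_
      · exact MeasurableSet.inter
          (((measurable_fst.comp measurable_fst).prodMk measurable_snd) G.measurableSet_E)
          ((measurable_snd.prodMk (measurable_snd.comp measurable_fst)) ih)
      · exact fun a y h => mem_componentOf_of_adj (G.edgeGraph_adj_iff.2 h.1)
  have hST : ∀ n, G.TransportsMass (S n) := by
    intro n
    induction n with
    | zero => exact G.transportsMass_diagonal
    | succ n ih => exact ih.comp (hSm n) (hSE n)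
  refine TransportsMass.iUnion hST hSm hSE F hF fun x y h0 => ?_
  obtain ⟨w⟩ : (edgeGraph G.E).Reachable x y := hsupp x y h0
  clear h0
  refine Set.mem_iUnion.2 ⟨w.length, ?_⟩
  induction w with
  | nil => exact Set.mem_diagonal _
  | cons hadj _ ih => exact ⟨_, G.edgeGraph_adj_iff.1 hadj, ih⟩

end Graphing

/-! ### Component density and partial transversals -/

namespace Graphing

section Basic

variable {J : Type*}

lemma invComponentSize_le_one (X : Set (J × J)) (x : J) : invComponentSize X x ≤ 1 := by
  refine ENNReal.inv_le_one.2 ?_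
  have : setSize {x} ≤ setSize (componentOf X x) :=
    setSize_mono (Set.singleton_subset_iff.2 (mem_componentOf_self X x))
  simpa [setSize] using this

lemma invComponentSize_eq_of_mem {X : Set (J × J)} {x y : J} (h : y ∈ componentOf X x) :
    invComponentSize X y = invComponentSize X x := by
  rw [invComponentSize, invComponentSize, componentOf_eq_of_mem h]

lemma componentOf_eq_singleton {X : Set (J × J)} {x : J}
    (h : ∀ y, ¬ (edgeGraph X).Adj x y) : componentOf X x = {x} := by
  refine Set.eq_singleton_iff_unique_mem.2 ⟨mem_componentOf_self X x, ?_⟩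
  rintro y ⟨w⟩
  cases w with
  | nil => rfl
  | cons hadj _ => exact (h _ hadj).elim

end Basic

variable {J : Type*} [MeasurableSpace J] [StandardBorelSpace J] (G : Graphing J)

/-- The density `1 - ρ(X)` of the finite components of `(J, X)`: the number of these components
per node. -/
noncomputable def componentDensity (X : Set (J × J)) : ℝ≥0∞ :=
  ∫⁻ x, invComponentSize X x ∂G.lam

lemma componentDensity_le_one (X : Set (J × J)) : G.componentDensity X ≤ 1 :=
  (lintegral_mono (invComponentSize_le_one X)).trans (by simp)

lemma componentDensity_anti {X Y : Set (J × J)} (h : X ⊆ Y) :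
    G.componentDensity Y ≤ G.componentDensity X :=
  lintegral_mono fun x => ENNReal.inv_le_inv.2 (setSize_mono (componentOf_mono h x))

lemma rho_eq (X : Set (J × J)) : G.rho X = 1 - (G.componentDensity X).toReal := rfl

variable {G}

/-- Mass transport with every node `x` sending `c x` to each node of `S` in its component. -/
lemma lintegral_mul_setSize_inter {X : Set (J × J)} (hX : X ∈ G.borelEdgeSets) {S : Set J}
    (hS : MeasurableSet S) {c : J → ℝ≥0∞} (hc : Measurable c)
    (hcX : ∀ x, ∀ y ∈ componentOf X x, c y = c x) :
    ∫⁻ x, c x * setSize (componentOf X x ∩ S) ∂G.lam =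
      ∫⁻ y in S, c y * setSize (componentOf X y) ∂G.lam := by
  let T : Set (J × J) := {p | p.2 ∈ componentOf X p.1 ∧ p.2 ∈ S}
  have hT : MeasurableSet T := (measurableSet_componentOf hX).inter (measurable_snd hS)
  let F : J → J → ℝ≥0∞ := fun x y => T.indicator (fun p => c p.1) (x, y)
  have hF : Measurable (Function.uncurry F) := (hc.comp measurable_fst).indicator hT
  have key := G.mass_transport hF fun x y h0 =>
    componentOf_mono hX.2 x (Set.mem_of_indicator_ne_zero h0 : (x, y) ∈ T).1
  have h1 : ∀ x, ∑' y, F x y = c x * setSize (componentOf X x ∩ S) := by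
    intro x
    rw [setSize_eq_tsum, ← ENNReal.tsum_mul_left]
    refine tsum_congr fun y => ?_
    by_cases hy : y ∈ componentOf X x ∩ S
    · rw [Set.indicator_of_mem hy, mul_one]
      exact Set.indicator_of_mem (s := T) hy _
    · rw [Set.indicator_of_notMem hy, mul_zero]
      exact Set.indicator_of_notMem (s := T) hy _
  have h2 : ∀ y, ∑' x, F x y = S.indicator (fun y => c y * setSize (componentOf X y)) y := by
    intro y
    by_cases hy : y ∈ S
    · rw [Set.indicator_of_mem hy, setSize_eq_tsum, ← ENNReal.tsum_mul_left]
      refine tsum_congr fun x => ?_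
      by_cases hx : x ∈ componentOf X y
      · rw [Set.indicator_of_mem hx, mul_one, ← hcX y x hx]
        exact Set.indicator_of_mem (s := T) ⟨mem_componentOf_comm.1 hx, hy⟩ _
      · rw [Set.indicator_of_notMem hx, mul_zero]
        exact Set.indicator_of_notMem (s := T) (fun h => hx (mem_componentOf_comm.1 h.1)) _
    · rw [Set.indicator_of_notMem hy]
      exact ENNReal.tsum_eq_zero.2 fun x =>
        Set.indicator_of_notMem (s := T) (fun h => hy h.2) _
  simp_rw [h1, h2] at key
  rw [key, lintegral_indicator hS]

/-- A Borel set meeting every component at most once has measure at most the component density;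
in particular, it meets almost no infinite component. -/
theorem measure_le_componentDensity {X : Set (J × J)} (hX : X ∈ G.borelEdgeSets) {S : Set J}
    (hS : MeasurableSet S) (h : ∀ x ∈ S, ∀ y ∈ S, y ∈ componentOf X x → x = y) :
    G.lam S ≤ G.componentDensity X := by
  have hle : ∀ x, setSize (componentOf X x ∩ S) ≤ 1 := by
    intro x
    have : (componentOf X x ∩ S).encard ≤ 1 := by
      refine Set.encard_le_one_iff.2 fun a b ha hb => h a ha.2 b hb.2 ?_
      rw [componentOf_eq_of_mem ha.1]; exact hb.1
    simpa [setSize] using ENat.toENNReal_le.2 this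
  -- sending mass `1` to the node of `S` in the own component shows that `∫_S |X_y| ≤ 1`
  have hfin : ∀ᵐ y ∂(G.lam.restrict S), setSize (componentOf X y) < ∞ := by
    refine ae_lt_top (measurable_setSize_componentOf hX) (ne_top_of_le_ne_top ENNReal.one_ne_top ?_)
    have := lintegral_mul_setSize_inter hX hS (c := 1) measurable_one fun _ _ _ => rfl
    simp only [Pi.one_apply, one_mul] at this
    rw [← this]
    exact (lintegral_mono hle).trans (by simp)
  calc G.lam S = ∫⁻ y in S, 1 ∂G.lam := by simp
    _ = ∫⁻ y in S, invComponentSize X y * setSize (componentOf X y) ∂G.lam := by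
        refine lintegral_congr_ae (hfin.mono fun y hy => ?_)
        exact (ENNReal.inv_mul_cancel (setSize_ne_zero ⟨y, mem_componentOf_self X y⟩) hy.ne).symm
    _ = ∫⁻ x, invComponentSize X x * setSize (componentOf X x ∩ S) ∂G.lam :=
        (lintegral_mul_setSize_inter hX hS (measurable_invComponentSize hX)
          fun _ _ => invComponentSize_eq_of_mem).symm
    _ ≤ G.componentDensity X :=
        lintegral_mono fun x => mul_le_of_le_one_right' (hle x)

/-- A Borel set meeting every finite component has measure at least the component density. -/
theorem componentDensity_le_measure {X : Set (J × J)} (hX : X ∈ G.borelEdgeSets) {S : Set J}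
    (hS : MeasurableSet S) (h : ∀ x, (componentOf X x).Finite → (componentOf X x ∩ S).Nonempty) :
    G.componentDensity X ≤ G.lam S := by
  calc G.componentDensity X
      ≤ ∫⁻ x, invComponentSize X x * setSize (componentOf X x ∩ S) ∂G.lam := by
        refine lintegral_mono fun x => ?_
        by_cases hx : (componentOf X x).Finite
        · refine le_mul_of_one_le_right' ?_
          simpa [setSize] using ENat.toENNReal_le.2 (Set.one_le_encard_iff_nonempty.2 (h x hx))
        · simp [invComponentSize, setSize_eq_top.2 hx]
    _ = ∫⁻ y in S, invComponentSize X y * setSize (componentOf X y) ∂G.lam :=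
        lintegral_mul_setSize_inter hX hS (measurable_invComponentSize hX)
          fun _ _ => invComponentSize_eq_of_mem
    _ ≤ ∫⁻ _ in S, 1 ∂G.lam := lintegral_mono fun y => ENNReal.inv_mul_le_one _
    _ = G.lam S := by simp

/-! ### Submodularity -/

section Potential

variable {J : Type*}

/-- The nodes at which `p` is minimal within their component of `(J, X)`. -/
def componentMinima {L : Type*} [LinearOrder L] (X : Set (J × J)) (p : J → L) : Set J :=
  {x | ∀ y ∈ componentOf X x, p x ≤ p y}

/-- The nodes at which `p` is minimal among their neighbors in `(J, X)`. -/
def localMinima {L : Type*} [LinearOrder L] (X : Set (J × J)) (p : J → L) : Set J :=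
  {x | ∀ y, (edgeGraph X).Adj x y → p x ≤ p y}

/-- The minimum of `f` over the ball of radius `n` in `(J, X)`. -/
noncomputable def ballMin (X : Set (J × J)) (f : J → EReal) (n : ℕ) (x : J) : EReal :=
  ⨅ y ∈ {y | (x, y) ∈ edgeBall X n}, f y

lemma ballMin_le {X : Set (J × J)} {f : J → EReal} {n : ℕ} {x y : J} (h : (x, y) ∈ edgeBall X n) :
    ballMin X f n x ≤ f y :=
  iInf₂_le (f := fun y (_ : y ∈ {y | (x, y) ∈ edgeBall X n}) => f y) y h

lemma ballMin_anti (X : Set (J × J)) (f : J → EReal) (x : J) :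
    Antitone fun n => ballMin X f n x :=
  fun _ _ hmn => biInf_mono fun _ hy => edgeBall_mono X hmn hy

end Potential

lemma measurableSet_forall_le {L : Type*} [LinearOrder L] {p : J → L}
    (hp : MeasurableSet {q : J × J | p q.1 < p q.2}) {R : Set (J × J)} (hR : MeasurableSet R)
    (hRE : ∀ x y, (x, y) ∈ R → y ∈ componentOf G.E x) :
    MeasurableSet {x | ∀ y, (x, y) ∈ R → p x ≤ p y} := by
  have : {x | ∀ y, (x, y) ∈ R → p x ≤ p y} =
      {x | ∃ y, (x, y) ∈ R ∩ Prod.swap ⁻¹' {q : J × J | p q.1 < p q.2}}ᶜ := by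
    ext x; simp
  rw [this]
  exact (G.measurableSet_exists (h := id) measurable_id (hR.inter (measurable_swap hp))
    fun x y h => hRE x y h.1).compl

/-- The combinatorial core of submodularity. Every node `y` in `componentMinima Y p` that is not a
local minimum of `p` on `X ∪ Y` has a smaller neighbor, necessarily along an edge of `X`, and is
therefore not minimal on its `X`-component. So the component minima for `X` and those component
minima for `Y` which are not local minima are distinct, and they lie in different components of
`X ∩ Y`. -/
theorem componentDensity_add_le_add_measure {L : Type*} [LinearOrder L] {p : J → L}
    (hpinj : Function.Injective p) (hp : MeasurableSet {q : J × J | p q.1 < p q.2})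
    {X Y : Set (J × J)} (hX : X ∈ G.borelEdgeSets) (hY : Y ∈ G.borelEdgeSets) :
    G.componentDensity X + G.componentDensity Y ≤
      G.componentDensity (X ∩ Y) + G.lam (localMinima (X ∪ Y) p) := by
  have hcm : ∀ {Z : Set (J × J)}, Z ∈ G.borelEdgeSets → MeasurableSet (componentMinima Z p) :=
    fun hZ => measurableSet_forall_le hp (measurableSet_componentOf hZ)
      fun x y h => componentOf_mono hZ.2 x h
  have hmeets : ∀ {Z : Set (J × J)} x, (componentOf Z x).Finite →
      (componentOf Z x ∩ componentMinima Z p).Nonempty := by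
    intro Z x hfin
    obtain ⟨y, hy, hmin⟩ := Set.exists_min_image _ p hfin ⟨x, mem_componentOf_self Z x⟩
    refine ⟨y, hy, fun z hz => hmin z ?_⟩
    rwa [componentOf_eq_of_mem hy] at hz
  have hunion : X ∪ Y ⊆ G.E := Set.union_subset hX.2 hY.2
  have hA : MeasurableSet (localMinima (X ∪ Y) p) :=
    measurableSet_forall_le hp (measurableSet_adj (hX.1.union hY.1))
      fun x y h => componentOf_mono hunion x (mem_componentOf_of_adj h)
  have hinter : X ∩ Y ∈ G.borelEdgeSets :=
    ⟨hX.1.inter hY.1, Set.inter_subset_left.trans hX.2⟩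
  set P := componentMinima X p
  set Q := componentMinima Y p
  set A := localMinima (X ∪ Y) p
  have hXs : ∀ {x y}, y ∈ componentOf (X ∩ Y) x → y ∈ componentOf X x := fun h =>
    componentOf_mono Set.inter_subset_left _ h
  have hYs : ∀ {x y}, y ∈ componentOf (X ∩ Y) x → y ∈ componentOf Y x := fun h =>
    componentOf_mono Set.inter_subset_right _ h
  have hPP : ∀ x ∈ P, ∀ y ∈ P, y ∈ componentOf (X ∩ Y) x → x = y := fun x hx y hy h =>
    hpinj (le_antisymm (hx y (hXs h)) (hy x (mem_componentOf_comm.1 (hXs h))))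
  have hQQ : ∀ x ∈ Q, ∀ y ∈ Q, y ∈ componentOf (X ∩ Y) x → x = y := fun x hx y hy h =>
    hpinj (le_antisymm (hx y (hYs h)) (hy x (mem_componentOf_comm.1 (hYs h))))
  have hPQ : ∀ x ∈ P, ∀ y ∈ Q \ A, y ∉ componentOf (X ∩ Y) x := by
    rintro x hx y ⟨hyQ, hyA⟩ h
    obtain ⟨z, hyz, hlt⟩ : ∃ z, (edgeGraph (X ∪ Y)).Adj y z ∧ p z < p y := by
      by_contra! hall
      exact hyA hall
    have hzY : ¬ (edgeGraph Y).Adj y z := fun hadj =>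
      (hyQ z (mem_componentOf_of_adj hadj)).not_gt hlt
    have hzX : (edgeGraph X).Adj y z := by
      simp only [edgeGraph, SimpleGraph.fromRel_adj, Set.mem_union] at hyz hzY ⊢
      tauto
    have hxz : z ∈ componentOf X x :=
      SimpleGraph.Reachable.trans (hXs h) hzX.reachable
    exact ((hx z hxz).trans_lt hlt).not_ge (hyQ x (mem_componentOf_comm.1 (hYs h)))
  calc G.componentDensity X + G.componentDensity Y ≤ G.lam P + G.lam Q :=
        add_le_add (componentDensity_le_measure hX (hcm hX) hmeets)
          (componentDensity_le_measure hY (hcm hY) hmeets)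
    _ ≤ G.lam P + (G.lam (Q \ A) + G.lam A) := by
        gcongr
        calc G.lam Q ≤ G.lam ((Q \ A) ∪ A) := measure_mono (by simp)
          _ ≤ _ := measure_union_le _ _
    _ = G.lam (P ∪ Q \ A) + G.lam A := by
        rw [measure_union _ ((hcm hY).diff hA), add_assoc]
        exact Set.disjoint_left.2 fun x hx hxQ => hPQ x hx x hxQ (mem_componentOf_self _ x)
    _ ≤ G.componentDensity (X ∩ Y) + G.lam A := by
        gcongr
        refine measure_le_componentDensity hinter ((hcm hX).union ((hcm hY).diff hA)) ?_
        rintro x (hx | hx) y (hy | hy) h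
        · exact hPP x hx y hy h
        · exact absurd h (hPQ x hx y hy)
        · exact absurd (mem_componentOf_comm.1 h) (hPQ y hy x hx)
        · exact hQQ x hx.1 y hy.1 h

lemma exists_mem_edgeBall_eq_ballMin {X : Set (J × J)} (hX : X ⊆ G.E) (f : J → EReal) (n : ℕ)
    (x : J) : ∃ y, (x, y) ∈ edgeBall X n ∧ f y = ballMin X f n x := by
  obtain ⟨y, hy, hmin⟩ := Set.exists_min_image _ f (finite_edgeBall hX n x)
    ⟨x, mem_edgeBall_self X n x⟩
  exact ⟨y, hy, le_antisymm (le_iInf₂ hmin) (iInf₂_le y hy)⟩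

lemma measurable_ballMin {X : Set (J × J)} (hX : X ∈ G.borelEdgeSets) {f : J → EReal}
    (hf : Measurable f) (n : ℕ) : Measurable (ballMin X f n) := by
  refine measurable_of_Iio fun a => ?_
  have : ballMin X f n ⁻¹' Set.Iio a = {x | ∃ y, (x, y) ∈ edgeBall X n ∩ {q | f q.2 < a}} := by
    ext x
    simp [ballMin, iInf_lt_iff]
  rw [this]
  refine G.measurableSet_exists (h := id) measurable_id
    ((measurableSet_edgeBall hX n).inter ?_)
    fun x y h => componentOf_mono hX.2 x (mem_componentOf_iff.2 ⟨n, h.1⟩)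
  exact measurableSet_lt (hf.comp measurable_snd) measurable_const

/-- Whenever the minimum of `f` over the ball of radius `R` around `x` is not attained at `x`, the
neighbor of `x` on a shortest path to the minimum is a step down in the lexicographic order of:
the minimum over the `R`-ball, the distance from that minimum, the value of `f`. This yields an
injective Borel potential all of whose local minima are minima of `f` over their `R`-balls. -/
theorem exists_potential {X : Set (J × J)} (hX : X ∈ G.borelEdgeSets) {f : J → EReal}
    (hf : Measurable f) (hfinj : Function.Injective f) (R : ℕ) :
    ∃ p : J → EReal ×ₗ ℕ ×ₗ EReal, Function.Injective p ∧
      MeasurableSet {q : J × J | p q.1 < p q.2} ∧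
      localMinima X p ⊆ {x | f x ≤ ballMin X f R x} := by
  classical
  let g := ballMin X f
  have hex : ∀ x, ∃ k, g k x = g R x := fun x => ⟨R, rfl⟩
  let d : J → ℕ := fun x => Nat.find (hex x)
  have hg : ∀ n, Measurable (g n) := measurable_ballMin hX hf
  have hd : Measurable d := measurable_find hex fun k => measurableSet_eq_fun (hg k) (hg R)
  refine ⟨fun x => toLex (g R x, toLex (d x, f x)), fun x y hxy => ?_, ?_, fun x hx => ?_⟩
  · simp only [EmbeddingLike.apply_eq_iff_eq, Prod.mk.injEq] at hxy
    exact hfinj hxy.2.2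
  · simp only [Prod.Lex.toLex_lt_toLex]
    have h1 := (hg R).comp (measurable_fst : Measurable (Prod.fst : J × J → J))
    have h2 := (hg R).comp (measurable_snd : Measurable (Prod.snd : J × J → J))
    have h3 := hd.comp (measurable_fst : Measurable (Prod.fst : J × J → J))
    have h4 := hd.comp (measurable_snd : Measurable (Prod.snd : J × J → J))
    exact (measurableSet_lt h1 h2).union ((measurableSet_eq_fun h1 h2).inter
      ((measurableSet_lt h3 h4).union ((measurableSet_eq_fun h3 h4).inter
        (measurableSet_lt (hf.comp measurable_fst) (hf.comp measurable_snd)))))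
  · by_contra hlt
    have hdx : g (d x) x = g R x := Nat.find_spec (hex x)
    obtain ⟨m, hm, hfm⟩ := exists_mem_edgeBall_eq_ballMin hX.2 f (d x) x
    have hfm' : f m = g R x := hfm.trans hdx
    rcases hk : d x with _ | k
    · rw [hk] at hm
      obtain rfl : x = m := hm
      exact hlt hfm'.le
    have hkR : k + 1 ≤ R := hk ▸ Nat.find_min' (hex x) rfl
    rw [hk] at hm
    rcases hm with hm | ⟨y, hxy, hm⟩
    · -- the minimum would be attained within distance `k`
      have : g k x = g R x :=
        le_antisymm ((ballMin_le hm).trans hfm'.le) (ballMin_anti X f x (by omega))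
      exact Nat.find_min (hex x) (show k < d x by omega) this
    · have hgk : g k y ≤ g R x := (ballMin_le hm).trans hfm'.le
      have hgR : g R y ≤ g k y := ballMin_anti X f y (by omega)
      refine (hx y hxy).not_gt ?_
      rw [Prod.Lex.toLex_lt_toLex, Prod.Lex.toLex_lt_toLex]
      rcases (hgR.trans hgk).lt_or_eq with h | h
      · exact .inl h
      · refine .inr ⟨h, .inl ?_⟩
        have : g k y = g R y := le_antisymm (hgk.trans h.ge) hgR
        have := Nat.find_min' (hex y) this
        change d y < d x
        change d y ≤ k at this
        omega

/-- Submodularity of `ρ`, in terms of the density of finite components. -/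
theorem componentDensity_supermodular {X Y : Set (J × J)} (hX : X ∈ G.borelEdgeSets)
    (hY : Y ∈ G.borelEdgeSets) :
    G.componentDensity X + G.componentDensity Y ≤
      G.componentDensity (X ∩ Y) + G.componentDensity (X ∪ Y) := by
  obtain ⟨f₀, hf₀⟩ := exists_measurableEmbedding_real J
  let f : J → EReal := fun x => (f₀ x : EReal)
  have hf : Measurable f := hf₀.measurable.coe_real_ereal
  have hfinj : Function.Injective f := EReal.coe_injective.comp hf₀.injective
  have hW : X ∪ Y ∈ G.borelEdgeSets := ⟨hX.1.union hY.1, Set.union_subset hX.2 hY.2⟩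
  let S : ℕ → Set J := fun R => {x | f x ≤ ballMin (X ∪ Y) f R x}
  have hS : ∀ R, MeasurableSet (S R) := fun R => measurableSet_le hf (measurable_ballMin hW hf R)
  have hle : ∀ R, G.componentDensity X + G.componentDensity Y ≤
      G.componentDensity (X ∩ Y) + G.lam (S R) := by
    intro R
    obtain ⟨p, hpinj, hp, hpS⟩ := exists_potential hW hf hfinj R
    exact (componentDensity_add_le_add_measure hpinj hp hX hY).trans
      (by gcongr)
  have hanti : Antitone S := fun m n hmn x hx => le_trans hx (ballMin_anti _ f x hmn)
  have hlim : Tendsto (fun R => G.componentDensity (X ∩ Y) + G.lam (S R)) atTop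
      (𝓝 (G.componentDensity (X ∩ Y) + G.lam (⋂ R, S R))) :=
    (tendsto_measure_iInter_atTop (fun R => (hS R).nullMeasurableSet) hanti
      ⟨0, measure_ne_top _ _⟩).const_add _
  refine (ge_of_tendsto' hlim hle).trans ?_
  gcongr
  refine measure_le_componentDensity hW (.iInter hS) fun x hx y hy h => hfinj ?_
  have hmin : ∀ {x y}, x ∈ ⋂ R, S R → y ∈ componentOf (X ∪ Y) x → f x ≤ f y := by
    intro x y hx h
    obtain ⟨n, hn⟩ := mem_componentOf_iff.1 h
    exact (Set.mem_iInter.1 hx n : f x ≤ _).trans (ballMin_le hn)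
  exact le_antisymm (hmin hx h) (hmin hy (mem_componentOf_comm.1 h))

end Graphing

/-! ### Continuity from above -/

namespace Graphing

variable {J : Type*} [MeasurableSpace J] [StandardBorelSpace J] {G : Graphing J}

/-- A finite component `C` of the intersection has finitely many boundary edges in `G`, and each of
them is missing from all but finitely many `A n`; hence `C` is a component of `A n` for large
`n`. -/
lemma eventually_componentOf_subset {A : ℕ → Set (J × J)} (hA : ∀ n, A n ⊆ G.E) (hanti : Antitone A)
    {x : J} (hfin : (componentOf (⋂ n, A n) x).Finite) :
    ∀ᶠ n in atTop, componentOf (A n) x ⊆ componentOf (⋂ n, A n) x := by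
  set C := componentOf (⋂ n, A n) x with hC
  have hedge : ∀ y ∈ C, ∀ z ∈ {z | (y, z) ∈ G.E}, ∀ᶠ n in atTop,
      (edgeGraph (A n)).Adj y z → z ∈ C := by
    intro y hy z _
    by_cases hz : z ∈ C
    · exact .of_forall fun _ _ => hz
    -- neither orientation of a boundary edge belongs to the intersection
    have hnot : ∀ p : J × J, (p = (y, z) ∨ p = (z, y)) → ∃ n, p ∉ A n := by
      intro p hp
      by_contra! hall
      have hpI : p ∈ ⋂ n, A n := Set.mem_iInter.2 hall
      refine hz (SimpleGraph.Reachable.trans (hy : (edgeGraph _).Reachable x y)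
        (SimpleGraph.Adj.reachable ?_))
      simp only [edgeGraph, SimpleGraph.fromRel_adj]
      refine ⟨fun h => hz (h ▸ hy), ?_⟩
      rcases hp with rfl | rfl
      · exact .inl hpI
      · exact .inr hpI
    obtain ⟨n, hn⟩ := hnot _ (.inl rfl)
    obtain ⟨m, hm⟩ := hnot _ (.inr rfl)
    filter_upwards [eventually_ge_atTop n, eventually_ge_atTop m] with k hkn hkm hadj
    simp only [edgeGraph, SimpleGraph.fromRel_adj] at hadj
    exact (hadj.2.elim (fun h => hn (hanti hkn h)) (fun h => hm (hanti hkm h))).elim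
  have hall : ∀ᶠ n in atTop, ∀ y ∈ C, ∀ z ∈ {z | (y, z) ∈ G.E},
      (edgeGraph (A n)).Adj y z → z ∈ C :=
    hfin.eventually_all.2 fun y hy => (G.finite_neighbors y).eventually_all.2 (hedge y hy)
  filter_upwards [hall] with n hn y hy
  obtain ⟨w⟩ : (edgeGraph (A n)).Reachable x y := hy
  have hclosed : ∀ {u v : J}, (edgeGraph (A n)).Walk u v → u ∈ C → v ∈ C := by
    intro u v w
    induction w with
    | nil => exact id
    | cons hadj _ ih => exact fun hu => ih (hn _ hu _ (mem_E_of_adj (hA n) hadj) hadj)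
  exact hclosed w (mem_componentOf_self _ x)

lemma tendsto_invComponentSize {A : ℕ → Set (J × J)} (hA : ∀ n, A n ⊆ G.E) (hanti : Antitone A)
    (x : J) : Tendsto (fun n => invComponentSize (A n) x) atTop
      (𝓝 (invComponentSize (⋂ n, A n) x)) := by
  refine tendsto_const_nhds.congr' ?_
  have hsub : ∀ n, componentOf (⋂ n, A n) x ⊆ componentOf (A n) x := fun n =>
    componentOf_mono (Set.iInter_subset A n) x
  by_cases hfin : (componentOf (⋂ n, A n) x).Finite
  · filter_upwards [eventually_componentOf_subset hA hanti hfin] with n hn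
    rw [invComponentSize, invComponentSize, (hsub n).antisymm hn]
  · refine .of_forall fun n => ?_
    simp only [invComponentSize, setSize_eq_top.2 hfin,
      setSize_eq_top.2 (Set.Infinite.mono (hsub n) hfin)]

variable (G) in
theorem rho_continuousFromAbove : ContinuousFromAboveOn G.borelEdgeSets G.rho := by
  intro A hA hanti
  have hI : Tendsto (fun n => G.componentDensity (A n)) atTop
      (𝓝 (G.componentDensity (⋂ n, A n))) :=
    tendsto_lintegral_of_dominated_convergence 1 (fun n => measurable_invComponentSize (hA n))
      (fun n => .of_forall (invComponentSize_le_one (A n))) (by simp)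
      (.of_forall (tendsto_invComponentSize (fun n => (hA n).2) hanti))
  have hne : G.componentDensity (⋂ n, A n) ≠ ∞ :=
    ne_top_of_le_ne_top ENNReal.one_ne_top (G.componentDensity_le_one _)
  exact tendsto_const_nhds.sub ((ENNReal.tendsto_toReal hne).comp hI)

/-! ### Domination by the edge measure -/

/-- Every node is isolated in `(J, X)` or incident to a pair in `X`, as its first or second
entry. -/
lemma one_le_componentDensity_add {X : Set (J × J)} (hX : X ∈ G.borelEdgeSets) :
    1 ≤ G.componentDensity X + 2 * G.adjMeasure X := by
  have hmeas : ∀ {S : Set (J × J)}, MeasurableSet S →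
      Measurable fun x => setSize {y | (x, y) ∈ S ∧ (x, y) ∈ G.E} := by
    intro S hS
    simp_rw [setSize_eq_tsum]
    refine G.measurable_tsum (h := id) measurable_id ?_ fun x y h => ?_
    · exact (measurable_const (a := (1 : ℝ≥0∞))).indicator (hS.inter G.measurableSet_E)
    · exact mem_componentOf_of_adj (G.edgeGraph_adj_iff.2 (Set.mem_of_indicator_ne_zero h).2)
  have hswap : G.adjMeasure (Prod.swap ⁻¹' X) = G.adjMeasure X := by
    rw [← Measure.map_apply measurable_swap hX.1, map_swap_adjMeasure]
  calc (1 : ℝ≥0∞) = ∫⁻ _, 1 ∂G.lam := by simp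
    _ ≤ ∫⁻ x, (invComponentSize X x + (setSize {y | (x, y) ∈ X ∧ (x, y) ∈ G.E} +
          setSize {y | (x, y) ∈ Prod.swap ⁻¹' X ∧ (x, y) ∈ G.E})) ∂G.lam := by
        refine lintegral_mono fun x => ?_
        by_cases h : ∃ y, (edgeGraph X).Adj x y
        · obtain ⟨y, hy⟩ := h
          have hyE := mem_E_of_adj hX.2 hy
          have one_le : ∀ {s : Set J}, y ∈ s → 1 ≤ setSize s := fun {s} hs => by
            simpa [setSize] using
              ENat.toENNReal_le.2 (Set.one_le_encard_iff_nonempty.2 ⟨y, hs⟩)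
          simp only [edgeGraph, SimpleGraph.fromRel_adj] at hy
          rcases hy.2 with h | h
          · exact le_add_left (le_add_right (one_le ⟨h, hyE⟩))
          · exact le_add_left (le_add_left (one_le ⟨h, hyE⟩))
        · have := componentOf_eq_singleton (not_exists.1 h)
          simp [invComponentSize, this, setSize]
    _ = G.componentDensity X + 2 * G.adjMeasure X := by
        rw [lintegral_add_left (measurable_invComponentSize hX), lintegral_add_left (hmeas hX.1),
          ← adjMeasure_apply G hX.1, ← adjMeasure_apply G (measurable_swap hX.1), hswap, two_mul]
        rfl

lemma rho_le_two_mul_adjMeasure {X : Set (J × J)} (hX : X ∈ G.borelEdgeSets) :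
    G.rho X ≤ 2 * G.adjMeasure.real X := by
  have hc : G.componentDensity X ≠ ∞ :=
    ne_top_of_le_ne_top ENNReal.one_ne_top (G.componentDensity_le_one X)
  have hm : 2 * G.adjMeasure X ≠ ∞ := ENNReal.mul_ne_top (by simp) (measure_ne_top _ _)
  have h := ENNReal.toReal_mono (ENNReal.add_ne_top.2 ⟨hc, hm⟩) (one_le_componentDensity_add hX)
  rw [ENNReal.toReal_add hc hm, ENNReal.toReal_mul] at h
  rw [rho_eq, Measure.real]
  simp only [ENNReal.toReal_one, ENNReal.toReal_ofNat] at h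
  linarith

lemma rho_nonneg (X : Set (J × J)) : 0 ≤ G.rho X := by
  have := ENNReal.toReal_mono ENNReal.one_ne_top (G.componentDensity_le_one X)
  rw [rho_eq]
  simp only [ENNReal.toReal_one] at this
  linarith

variable (G) in
theorem rho_stronglyBounded : StronglyBoundedOn G.borelEdgeSets G.rho := by
  refine ⟨fun X _ => rho_nonneg X, G.adjMeasure + G.adjMeasure, inferInstance, fun X hX => ?_⟩
  rw [measureReal_add_apply, ← two_mul]
  exact rho_le_two_mul_adjMeasure hX

variable (G) in
/-- The unnormalized edge measure is `d` times the edge measure, also in the degenerate case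
`d = 0` in which both vanish. -/
lemma adjMeasure_eq_avgDegree_mul (S : Set (J × J)) :
    G.adjMeasure S = G.avgDegree * G.edgeMeasure S := by
  rw [edgeMeasure_eq, Measure.smul_apply, smul_eq_mul, ← mul_assoc]
  by_cases h0 : G.avgDegree = 0
  · have : G.adjMeasure S ≤ 0 := (measure_mono (Set.subset_univ S)).trans
      (by rw [adjMeasure_univ, h0])
    simpa [h0] using this
  · rw [ENNReal.mul_inv_cancel h0 G.avgDegree_ne_top, one_mul]

variable (G) in
theorem rho_absCont : AbsContOn G.borelEdgeSets G.rho G.edgeMeasure := by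
  intro ε hε
  set d := G.avgDegree.toReal
  have hd : 0 ≤ d := ENNReal.toReal_nonneg
  refine ⟨ε / (2 * d + 1), by positivity, fun S hS hlt => ?_⟩
  have hη : (G.edgeMeasure S).toReal < ε / (2 * d + 1) :=
    (ENNReal.lt_ofReal_iff_toReal_lt hlt.ne_top).1 hlt
  have hη0 : 0 ≤ (G.edgeMeasure S).toReal := ENNReal.toReal_nonneg
  rw [abs_of_nonneg (rho_nonneg S)]
  calc G.rho S ≤ 2 * G.adjMeasure.real S := rho_le_two_mul_adjMeasure hS
    _ = 2 * d * (G.edgeMeasure S).toReal := by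
        rw [Measure.real, adjMeasure_eq_avgDegree_mul, ENNReal.toReal_mul, mul_assoc]
    _ ≤ (2 * d + 1) * (G.edgeMeasure S).toReal := by gcongr; linarith
    _ < ε := by rwa [lt_div_iff₀' (by positivity)] at hη

/-! ### Monotonicity and submodularity of the rank function -/

variable (G) in
theorem rho_increasing : IncreasingOn G.borelEdgeSets G.rho := by
  intro X _ Y _ h
  rw [rho_eq, rho_eq]
  exact sub_le_sub_left (ENNReal.toReal_mono
    (ne_top_of_le_ne_top ENNReal.one_ne_top (G.componentDensity_le_one X))
    (G.componentDensity_anti h)) 1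

variable (G) in
theorem rho_submodular : SubmodularOn G.borelEdgeSets G.rho := by
  intro X hX Y hY
  have hne : ∀ Z, G.componentDensity Z ≠ ∞ := fun Z =>
    ne_top_of_le_ne_top ENNReal.one_ne_top (G.componentDensity_le_one Z)
  have h := ENNReal.toReal_mono (ENNReal.add_ne_top.2 ⟨hne _, hne _⟩)
    (componentDensity_supermodular hX hY)
  rw [ENNReal.toReal_add (hne _) (hne _), ENNReal.toReal_add (hne _) (hne _)] at h
  simp only [rho_eq]
  linarith

end Graphing

/-! ### Finite graphs -/

/-- Summing degrees over the trees that are the components of a finite forest. -/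
lemma SimpleGraph.IsAcyclic.ncard_edgeSet_add_card_connectedComponent {V : Type*} [Finite V]
    {F : SimpleGraph V} (hF : F.IsAcyclic) :
    F.edgeSet.ncard + Nat.card F.ConnectedComponent = Nat.card V := by
  classical
  have := Fintype.ofFinite V
  have hdeg : ∀ c : F.ConnectedComponent, ∀ v : c,
      F.degree v = c.toSimpleGraph.degree v := by
    intro c v
    symm
    convert! SimpleGraph.degree_induce_of_neighborSet_subset (G := F) (s := c.supp) (v := v) ?_
    intro w hw
    exact (c.mem_supp_congr_adj hw).1 v.2
  have hcard : Fintype.card V = ∑ c : F.ConnectedComponent, Fintype.card c := by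
    rw [← Fintype.card_sigma]
    exact Fintype.card_congr (Equiv.sigmaFiberEquiv F.connectedComponentMk).symm
  have hsum : ∑ v, F.degree v = ∑ c : F.ConnectedComponent, ∑ v : c, F.degree v := by
    rw [← Fintype.sum_sigma']
    exact (Equiv.sum_comp (Equiv.sigmaFiberEquiv F.connectedComponentMk) _).symm
  have htree : ∀ c : F.ConnectedComponent,
      c.toSimpleGraph.edgeFinset.card + 1 = Fintype.card c := fun c =>
    (hF.isTree_connectedComponent c).card_edgeFinset
  have h2 : 2 * F.edgeFinset.card =
      ∑ c : F.ConnectedComponent, 2 * c.toSimpleGraph.edgeFinset.card := by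
    rw [← F.sum_degrees_eq_twice_card_edges, hsum]
    refine Finset.sum_congr rfl fun c _ => ?_
    rw [← c.toSimpleGraph.sum_degrees_eq_twice_card_edges]
    exact Finset.sum_congr rfl fun v _ => hdeg c v
  rw [← Finset.mul_sum] at h2
  have h3 : F.edgeFinset.card = ∑ c : F.ConnectedComponent, c.toSimpleGraph.edgeFinset.card := by
    omega
  rw [← SimpleGraph.coe_edgeFinset, Set.ncard_coe_finset, Nat.card_eq_fintype_card,
    Nat.card_eq_fintype_card, hcard, h3, ← Finset.card_univ, Finset.card_eq_sum_ones,
    ← Finset.sum_add_distrib]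
  exact Finset.sum_congr rfl fun c _ => htree c

/-- The rank in the cycle matroid is the number of nodes minus the number of components. -/
theorem cycleMatroidRank_add_card_connectedComponent {V : Type*} [Finite V] (X : Set (V × V)) :
    cycleMatroidRank X + Nat.card (edgeGraph X).ConnectedComponent = Nat.card V := by
  obtain ⟨F, hFle, hF, hreach⟩ := (edgeGraph X).exists_isAcyclic_reachable_eq_le
  have hcard : Nat.card F.ConnectedComponent = Nat.card (edgeGraph X).ConnectedComponent := by
    unfold SimpleGraph.ConnectedComponent
    rw [hreach]
  have hgreatest : IsGreatest {n | ∃ F : SimpleGraph V, F ≤ edgeGraph X ∧ F.IsAcyclic ∧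
      F.edgeSet.ncard = n} F.edgeSet.ncard := by
    refine ⟨⟨F, hFle, hF, rfl⟩, ?_⟩
    rintro _ ⟨F', hle, hF', rfl⟩
    have h1 := hF.ncard_edgeSet_add_card_connectedComponent
    have h2 := hF'.ncard_edgeSet_add_card_connectedComponent
    have h3 := SimpleGraph.ConnectedComponent.card_le_card_of_le hle
    omega
  rw [cycleMatroidRank, hgreatest.csSup_eq, ← hcard, hF.ncard_edgeSet_add_card_connectedComponent]

/-- The component density of a finite graph: a set of representatives of the components is a
transversal. -/
lemma Graphing.componentDensity_ofFinite {V : Type*} [Finite V] [Nonempty V] [MeasurableSpace V]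
    [DiscreteMeasurableSpace V] (H : SimpleGraph V) {X : Set (V × V)} (hX : X ⊆ adjPairs H) :
    (Graphing.ofFinite H).componentDensity X =
      Nat.card (edgeGraph X).ConnectedComponent / Nat.card V := by
  have := Fintype.ofFinite V
  have hXm : X ∈ (Graphing.ofFinite H).borelEdgeSets := ⟨.of_discrete, hX⟩
  let out : (edgeGraph X).ConnectedComponent → V := Quot.out
  have hout : ∀ c, (edgeGraph X).connectedComponentMk (out c) = c := Quot.out_eq
  have hinj : Function.Injective out := Function.LeftInverse.injective hout
  have hS : (Graphing.ofFinite H).lam (Set.range out) =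
      Nat.card (edgeGraph X).ConnectedComponent / Nat.card V := by
    change ProbabilityTheory.uniformOn Set.univ (Set.range out) = _
    rw [ProbabilityTheory.uniformOn_univ, Measure.count_apply .of_discrete, ← Set.image_univ,
      hinj.encard_image, Set.encard_univ, ENat.card_eq_coe_natCard,
      Nat.card_eq_fintype_card (α := V)]
    simp
  rw [← hS]
  refine le_antisymm (componentDensity_le_measure hXm .of_discrete fun x _ => ?_)
    (measure_le_componentDensity hXm .of_discrete ?_)
  · refine ⟨out ((edgeGraph X).connectedComponentMk x), ?_, Set.mem_range_self _⟩
    exact (SimpleGraph.ConnectedComponent.eq.1 (hout _)).symm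
  · rintro _ ⟨c, rfl⟩ _ ⟨c', rfl⟩ h
    have := SimpleGraph.ConnectedComponent.eq.2 (h : (edgeGraph X).Reachable _ _)
    rw [hout, hout] at this
    rw [this]

theorem Graphing.rho_ofFinite {V : Type*} [Finite V] [Nonempty V] [MeasurableSpace V]
    [DiscreteMeasurableSpace V] (H : SimpleGraph V) {X : Set (V × V)} (hX : X ⊆ adjPairs H) :
    (Graphing.ofFinite H).rho X = (cycleMatroidRank X : ℝ) / Nat.card V := by
  have hV : (Nat.card V : ℝ) ≠ 0 := Nat.cast_ne_zero.2 Nat.card_pos.ne'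
  have h : (cycleMatroidRank X : ℝ) + Nat.card (edgeGraph X).ConnectedComponent = Nat.card V := by
    exact_mod_cast cycleMatroidRank_add_card_connectedComponent X
  rw [rho_eq, componentDensity_ofFinite H hX, ENNReal.toReal_div, ENNReal.toReal_natCast,
    ENNReal.toReal_natCast, eq_div_iff hV, sub_mul, div_mul_cancel₀ _ hV]
  linarith

theorem mainTheorem1 {J : Type u} [MeasurableSpace J] [StandardBorelSpace J] (G : Graphing J) :
    -- the expectation defining `ρ` makes sense
    (∀ X ∈ G.borelEdgeSets, Measurable (Graphing.invComponentSize X)) ∧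
    -- `η (A × B) = d⁻¹ ∫_A deg_B`
    (∀ A B : Set J, MeasurableSet A → MeasurableSet B →
      G.edgeMeasure (A ×ˢ B) = G.avgDegree⁻¹ * ∫⁻ x in A, G.degTo B x ∂G.lam) ∧
    IncreasingOn G.borelEdgeSets G.rho ∧
    SubmodularOn G.borelEdgeSets G.rho ∧
    StronglyBoundedOn G.borelEdgeSets G.rho ∧
    ContinuousFromAboveOn G.borelEdgeSets G.rho ∧
    AbsContOn G.borelEdgeSets G.rho G.edgeMeasure ∧
    -- for finite graphs, `ρ` is the normalized rank function of the cycle matroid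
    (∀ (V : Type v) [Finite V] [Nonempty V] [MeasurableSpace V] [DiscreteMeasurableSpace V]
      (H : SimpleGraph V), ∀ X ⊆ adjPairs H,
      (Graphing.ofFinite H).rho X = (cycleMatroidRank X : ℝ) / Nat.card V) := by
  refine ⟨fun X hX => Graphing.measurable_invComponentSize hX, fun A B hA hB => ?_,
    G.rho_increasing, G.rho_submodular, G.rho_stronglyBounded, G.rho_continuousFromAbove,
    G.rho_absCont, fun V _ _ _ _ H X hX => Graphing.rho_ofFinite H hX⟩
  rw [G.edgeMeasure_eq, Measure.smul_apply, G.adjMeasure_prod hA hB, smul_eq_mul]
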